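/- **Theorem.** An instance of Integer Quadratic Programming (IQP) consists of integers $n,m\ge 0$, an integer $n\times n$ matrix $Q$ (not necessarily symmetric), an integer $m\times n$ matrix $A$ and a vector $b\in\mathbb{Z}^m$; the task is to minimize $x^TQx$ subject to $Ax\le b$, $x\in\mathbb{Z}^n$. An $x\in\mathbb{Z}^n$ with $Ax\le b$ is a feasible solution; the instance is feasible if it has one, it is unbounded if for every $\beta\in\mathbb{Z}$ there is a feasible solution $x$ with $x^TQx\le\beta$, and it is bounded otherwise. Let $\alpha$ be the maximum absolute value of an entry of $Q$ and $A$ ($0$ if there are no entries), and let $L$ be the total number of bits of $n$, $m$ and the entries of $Q$, $A$, $b$. There are a function $f:\mathbb{N}^2\to\mathbb{N}$, a constant $c$ and a single algorithm (a program of a random access machine under the logarithmic cost criterion) that, on every instance of IQP, halts within time $f(n,\alpha)\cdot L^{c}$ and determines whether the instance is infeasible, feasible and unbounded, or feasible and bounded. If the instance is feasible and bounded, the algorithm outputs an optimal solution, that is, a feasible solution $x$ such that $x^TQx$ is minimum among all feasible solutions. -/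

import Mathlib

/-! ## Random access machines with logarithmic cost

The running time is measured on the usual random access machine under the logarithmic cost
criterion, programmed by structured (`while`) programs.  Memory consists of integer registers and
of integer arrays; a program is a finite object and names finitely many of them.  Every operation
is charged the bit lengths of the integers it handles, including the addresses, so that the model
is polynomially equivalent to Turing machines. -/

namespace RAM

/-- Number of bits of an integer: its binary digits and a sign bit. -/
def bitLen (z : ℤ) : ℕ := Nat.size z.natAbs + 1

/-- A memory configuration: the contents of the registers, and of the cells of the arrays. -/
@[ext]
structure State where
  reg : ℕ → ℤ
  arr : ℕ → ℤ → ℤ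

namespace State

/-- Write `v` into register `x`. -/
def setReg (s : State) (x : ℕ) (v : ℤ) : State :=
  { s with reg := Function.update s.reg x v }

/-- Write `v` into the cell of array `k` with index `i`. -/
def setArr (s : State) (k : ℕ) (i v : ℤ) : State :=
  { s with arr := Function.update s.arr k (Function.update (s.arr k) i v) }

end State

/-- The arithmetic operations. -/
inductive Op where
  | add | sub | mul | div

/-- `div` is division with remainder (and returns `0` if the divisor is `0`). -/
def Op.apply : Op → ℤ → ℤ → ℤ
  | .add, a, b => a + b
  | .sub, a, b => a - b
  | .mul, a, b => a * b
  | .div, a, b => a / b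

/-- Programs. Natural numbers are names of registers (`x`, `y`, `z`) and of arrays (`k`). -/
inductive Prog where
  /-- do nothing -/
  | skip
  /-- `x := v` -/
  | const (x : ℕ) (v : ℤ)
  /-- `x := y o z` -/
  | arith (o : Op) (x y z : ℕ)
  /-- `x := k[y]` -/
  | load (x k y : ℕ)
  /-- `k[y] := x` -/
  | store (k y x : ℕ)
  /-- `p; q` -/
  | seq (p q : Prog)
  /-- `if 0 < x then p else q` -/
  | ite (x : ℕ) (p q : Prog)
  /-- `while 0 < x do p` -/
  | loop (x : ℕ) (p : Prog)

/-- `Exec p s s' t`: started in the state `s`, the program `p` halts in the state `s'` after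
time `t`. -/
inductive Exec : Prog → State → State → ℕ → Prop
  | skip (s : State) : Exec .skip s s 1
  | const (s : State) (x : ℕ) (v : ℤ) :
      Exec (.const x v) s (s.setReg x v) (1 + bitLen v)
  | arith (s : State) (o : Op) (x y z : ℕ) :
      Exec (.arith o x y z) s (s.setReg x (o.apply (s.reg y) (s.reg z)))
        (1 + bitLen (s.reg y) + bitLen (s.reg z))
  | load (s : State) (x k y : ℕ) :
      Exec (.load x k y) s (s.setReg x (s.arr k (s.reg y)))
        (1 + bitLen (s.reg y) + bitLen (s.arr k (s.reg y)))
  | store (s : State) (k y x : ℕ) :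
      Exec (.store k y x) s (s.setArr k (s.reg y) (s.reg x))
        (1 + bitLen (s.reg y) + bitLen (s.reg x))
  | seq {p q : Prog} {s s' s'' : State} {t t' : ℕ} :
      Exec p s s' t → Exec q s' s'' t' → Exec (.seq p q) s s'' (t + t')
  | ite_pos {x : ℕ} {p q : Prog} {s s' : State} {t : ℕ} :
      0 < s.reg x → Exec p s s' t → Exec (.ite x p q) s s' (1 + bitLen (s.reg x) + t)
  | ite_neg {x : ℕ} {p q : Prog} {s s' : State} {t : ℕ} :
      ¬ 0 < s.reg x → Exec q s s' t → Exec (.ite x p q) s s' (1 + bitLen (s.reg x) + t)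
  | loop_done {x : ℕ} {p : Prog} {s : State} :
      ¬ 0 < s.reg x → Exec (.loop x p) s s (1 + bitLen (s.reg x))
  | loop_step {x : ℕ} {p : Prog} {s s' s'' : State} {t t' : ℕ} :
      0 < s.reg x → Exec p s s' t → Exec (.loop x p) s' s'' t' →
        Exec (.loop x p) s s'' (1 + bitLen (s.reg x) + t + t')

/-- The machine is deterministic: a program that halts does so in only one way. -/
theorem Exec.unique {p : Prog} {s s₁ s₂ : State} {t₁ t₂ : ℕ}
    (h₁ : Exec p s s₁ t₁) (h₂ : Exec p s s₂ t₂) : s₁ = s₂ ∧ t₁ = t₂ := by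
  induction h₁ generalizing s₂ t₂ with
  | skip => cases h₂; simp
  | const => cases h₂; simp
  | arith => cases h₂; simp
  | load => cases h₂; simp
  | store => cases h₂; simp
  | seq _ _ ih ih' =>
    cases h₂ with
    | seq a b =>
      obtain ⟨rfl, rfl⟩ := ih a
      obtain ⟨rfl, rfl⟩ := ih' b
      simp
  | ite_pos h _ ih =>
    cases h₂ with
    | ite_pos _ a => obtain ⟨rfl, rfl⟩ := ih a; simp
    | ite_neg h' _ => exact absurd h h'
  | ite_neg h _ ih =>
    cases h₂ with
    | ite_pos h' _ => exact absurd h' h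
    | ite_neg _ a => obtain ⟨rfl, rfl⟩ := ih a; simp
  | loop_done h =>
    cases h₂ with
    | loop_done _ => simp
    | loop_step h' _ _ => exact absurd h' h
  | loop_step h _ _ ih ih' =>
    cases h₂ with
    | loop_done h' => exact absurd h h'
    | loop_step _ a b =>
      obtain ⟨rfl, rfl⟩ := ih a
      obtain ⟨rfl, rfl⟩ := ih' b
      simp

/-- The array that holds the vector `v` in its cells `0, …, k - 1`, and `0` elsewhere. -/
def vecArr {k : ℕ} (v : Fin k → ℤ) : ℤ → ℤ :=
  fun z => if h : 0 ≤ z ∧ z.toNat < k then v ⟨z.toNat, h.2⟩ else 0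

/-- The array that holds the `m × n` matrix `M` row by row. -/
def matArr {m n : ℕ} (M : Matrix (Fin m) (Fin n) ℤ) : ℤ → ℤ :=
  vecArr fun k : Fin (m * n) => M k.divNat k.modNat

end RAM

/-! ## Integer quadratic programs -/

/-- An instance of Integer Quadratic Programming:
minimize `xᵀ Q x` subject to `A x ≤ b` and `x ∈ ℤⁿ`. -/
structure IQP where
  /-- number of variables -/
  n : ℕ
  /-- number of constraints -/
  m : ℕ
  Q : Matrix (Fin n) (Fin n) ℤ
  A : Matrix (Fin m) (Fin n) ℤ
  b : Fin m → ℤ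

namespace IQP

open Matrix RAM

/-- The objective function `xᵀ Q x`. -/
def objective (I : IQP) (x : Fin I.n → ℤ) : ℤ := x ⬝ᵥ (I.Q *ᵥ x)

/-- `x` is a feasible solution: `A x ≤ b`. -/
def IsFeasible (I : IQP) (x : Fin I.n → ℤ) : Prop := ∀ i, (I.A *ᵥ x) i ≤ I.b i

/-- The instance has a feasible solution. -/
def Feasible (I : IQP) : Prop := ∃ x, I.IsFeasible x

/-- For every integer `β` there is a feasible solution of objective value at most `β`. -/
def Unbounded (I : IQP) : Prop := ∀ β : ℤ, ∃ x, I.IsFeasible x ∧ I.objective x ≤ β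

/-- `x` is feasible and minimizes the objective function over all feasible solutions. -/
def IsOptimal (I : IQP) (x : Fin I.n → ℤ) : Prop :=
  I.IsFeasible x ∧ ∀ y, I.IsFeasible y → I.objective x ≤ I.objective y

/-- The largest absolute value `α` of an entry of `Q` and `A` (`0` if there are no entries). -/
def alpha (I : IQP) : ℕ :=
  max (Finset.univ.sup fun p : Fin I.n × Fin I.n => (I.Q p.1 p.2).natAbs)
    (Finset.univ.sup fun p : Fin I.m × Fin I.n => (I.A p.1 p.2).natAbs)

/-- The length `L` of the bit representation of the instance. -/
def size (I : IQP) : ℕ :=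
  bitLen I.n + bitLen I.m + ∑ i, ∑ j, bitLen (I.Q i j) + ∑ i, ∑ j, bitLen (I.A i j) +
    ∑ i, bitLen (I.b i)

/-- The initial memory on input `I`: registers `0` and `1` hold `n` and `m`, the arrays `0`, `1`
and `2` hold `Q`, `A` and `b`, and everything else is `0`. -/
def input (I : IQP) : State where
  reg := fun x => if x = 0 then I.n else if x = 1 then I.m else 0
  arr := fun k => if k = 0 then matArr I.Q else if k = 1 then matArr I.A
    else if k = 2 then vecArr I.b else fun _ => 0

/-- The three possible answers to an instance with `n` variables. -/
inductive Answer (n : ℕ) where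
  | infeasible
  | unbounded
  | optimum (x : Fin n → ℤ)

/-- When the final memory represents a given answer: register `0` holds `0`, `1` or `2` for
"infeasible", "unbounded" or "bounded", and in the last case array `0` begins with the solution. -/
def Answer.WrittenIn {n : ℕ} (s : State) : Answer n → Prop
  | .infeasible => s.reg 0 = 0
  | .unbounded => s.reg 0 = 1
  | .optimum x => s.reg 0 = 2 ∧ ∀ i : Fin n, s.arr 0 (i : ℕ) = x i

/-- When an answer is correct for the instance `I`. -/
def Answer.IsCorrect (I : IQP) : Answer I.n → Prop
  | .infeasible => ¬ I.Feasible
  | .unbounded => I.Feasible ∧ I.Unbounded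
  | .optimum x => I.Feasible ∧ ¬ I.Unbounded ∧ I.IsOptimal x

end IQP

/-! The plan is to produce, from `n` and `α` alone, a finite list of recipes for candidate solutions
such that one of the following holds: some recipe proves unboundedness, or every feasible point is
matched or beaten by a feasible candidate. The algorithm then tries all recipes.

The constraints have at most `(2α + 1)^n` different left-hand sides, and of the constraints that
share one only the smallest right-hand side matters. Call these right-hand sides `β k`; their number
depends only on `n` and `α`. A number is tame if it is an integer combination of the `β k` and `1`
with small coefficients. A candidate is a point `x` such that `D x` has tame coordinates for some
small `D ≥ 1`.

Candidates arise by descent. Start at a feasible point and maintain linearly independent small rows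
whose values at the point are tame. While there are fewer than `n` rows, Siegel's lemma gives a
small nonzero vector `y` in their common kernel, and moving along `y` preserves all the equations.
Restricted to this line the objective is a quadratic polynomial, and `step` shows that, without
increasing it, one reaches a point where one of the following supplies a new tame equation not
vanishing on `y`: a nearly tight constraint, a small derivative, or a coordinate reduced modulo `y
j`. The only alternative is a small recession direction along which the objective tends to minus
infinity. Each round raises the bounds to the power `4 n + 4`. After `n` rounds Cramer's rule turns
the equations into a candidate (`exists_independent_rows`, `candidate_of_independent_rows`).

In the unbounded case the direction may descend only from certain base points. A second descent, for
the linear objective given by the gradient along that direction, finds either a suitable base point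
among the candidates or another direction that can be combined with the first into one with negative
quadratic form (`unbounded_or_candidates`). So unboundedness too is witnessed by a candidate and a
small vector.

A recipe is the list of coefficients of a candidate and a direction, read as the digits of one
number below `total`. The program loops over these numbers. Running times are tracked with two
units: values are bounded by powers of `U = F * 2 ^ L` and times by powers of `W = F * L`, where `F`
depends only on `n` and `α`. A fixed program involves only fixed exponents, whence the bound `F ^ c
* L ^ c`. -/

namespace IQP

open Matrix

/-! ### Descent along kernel directions to small candidates -/

section Descent

variable {n m : ℕ} {ι : Type*} [Fintype ι]

theorem abs_dotProduct_le {x y : Fin n → ℤ} {X Y : ℤ} (hx : ∀ i, |x i| ≤ X)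
    (hy : ∀ i, |y i| ≤ Y) : |x ⬝ᵥ y| ≤ n * (X * Y) := by
  calc |x ⬝ᵥ y| ≤ ∑ i, |x i * y i| := Finset.abs_sum_le_sum_abs _ _
    _ ≤ ∑ _i : Fin n, X * Y := by
        refine Finset.sum_le_sum fun i _ => ?_
        rw [abs_mul]
        exact mul_le_mul (hx i) (hy i) (abs_nonneg _) ((abs_nonneg _).trans (hx i))
    _ = n * (X * Y) := by simp

/-- A quadratic polynomial without constant term. -/
def quad (Q : Matrix (Fin n) (Fin n) ℤ) (q x : Fin n → ℤ) : ℤ := x ⬝ᵥ Q *ᵥ x + q ⬝ᵥ x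

/-- The linear form `x ↦ xᵀ (Q + Qᵀ) y`. -/
def gradRow (Q : Matrix (Fin n) (Fin n) ℤ) (y : Fin n → ℤ) : Fin n → ℤ := Q *ᵥ y + y ᵥ* Q

/-- The derivative of `quad Q q` at `x` in direction `y`. -/
def slope (Q : Matrix (Fin n) (Fin n) ℤ) (q x y : Fin n → ℤ) : ℤ :=
  gradRow Q y ⬝ᵥ x + q ⬝ᵥ y

theorem gradRow_dotProduct (Q : Matrix (Fin n) (Fin n) ℤ) (x y : Fin n → ℤ) :
    gradRow Q y ⬝ᵥ x = x ⬝ᵥ Q *ᵥ y + y ⬝ᵥ Q *ᵥ x := by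
  rw [gradRow, add_dotProduct, dotProduct_comm, dotProduct_mulVec y]

theorem quad_add_smul (Q : Matrix (Fin n) (Fin n) ℤ) (q x y : Fin n → ℤ) (t : ℤ) :
    quad Q q (x + t • y) = quad Q q x + t * slope Q q x y + t ^ 2 * (y ⬝ᵥ Q *ᵥ y) := by
  simp only [quad, slope, gradRow_dotProduct, mulVec_add, mulVec_smul, dotProduct_add,
    add_dotProduct, smul_dotProduct, dotProduct_smul, smul_eq_mul]
  ring

theorem slope_neg (Q : Matrix (Fin n) (Fin n) ℤ) (q x y : Fin n → ℤ) :
    slope Q q x (-y) = - slope Q q x y := by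
  simp only [slope, gradRow, mulVec_neg, neg_vecMul, add_dotProduct, neg_dotProduct,
    dotProduct_neg]
  ring

/-- `c` is an integer combination of the numbers `β k` and `1` with coefficients at most `Z`. -/
def Tame (β : ι → ℤ) (Z c : ℤ) : Prop :=
  ∃ (u : ι → ℤ) (w : ℤ), (∀ k, |u k| ≤ Z) ∧ |w| ≤ Z ∧ c = ∑ k, u k * β k + w

theorem Tame.mono {β : ι → ℤ} {Z Z' c : ℤ} (h : Tame β Z c) (hZ : Z ≤ Z') : Tame β Z' c := by
  obtain ⟨u, w, hu, hw, rfl⟩ := h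
  exact ⟨u, w, fun k => (hu k).trans hZ, hw.trans hZ, rfl⟩

theorem Tame.of_abs_le {β : ι → ℤ} {Z c : ℤ} (h : |c| ≤ Z) : Tame β Z c :=
  ⟨0, c, fun _ => by simpa using (abs_nonneg c).trans h, h, by simp⟩

/-- The right-hand sides `β k` cover all constraints that are not redundant. -/
def Covers (A : Matrix (Fin m) (Fin n) ℤ) (b : Fin m → ℤ) (β : ι → ℤ) : Prop :=
  ∀ i, ∃ i', A i' = A i ∧ b i' ≤ b i ∧ ∃ k, b i' = β k

/-- If one step `y` violates a constraint, then `x` is within `|A i ⬝ᵥ y|` of its boundary. By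
`Covers` the right-hand side can be replaced by some `β k`, at most as large and still valid at `x`,
so the slack stays small. The summand `1` in the bound makes room for the coefficient of `β k`. -/
theorem exists_wall {A : Matrix (Fin m) (Fin n) ℤ} {b : Fin m → ℤ} {β : ι → ℤ}
    (hβ : Covers A b β) {x y : Fin n → ℤ} {Z Y : ℤ} (hA : ∀ i j, |A i j| ≤ Z)
    (hy : ∀ j, |y j| ≤ Y) (hx : A *ᵥ x ≤ b) (hxy : ¬ A *ᵥ (x + y) ≤ b) :
    ∃ i, Tame β (n * (Z * Y) + 1) (A i ⬝ᵥ x) ∧ A i ⬝ᵥ y ≠ 0 := by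
  classical
  simp only [Pi.le_def, not_forall, not_le] at hxy
  obtain ⟨i, hi⟩ := hxy
  obtain ⟨i', hA', hb', k, hk⟩ := hβ i
  have h1 : A i ⬝ᵥ x ≤ b i' := hA' ▸ hx i'
  have h2 : b i < A i ⬝ᵥ x + A i ⬝ᵥ y := by
    rw [← dotProduct_add]; exact hi
  have h3 := abs_le.1 (abs_dotProduct_le (hA i) hy)
  refine ⟨i, ⟨Pi.single k 1, A i ⬝ᵥ x - b i', fun l => ?_, ?_, ?_⟩, by lia⟩
  · have : |(Pi.single k 1 : ι → ℤ) l| ≤ 1 := by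
      by_cases h : l = k
      · subst h; simp
      · simp [h]
    lia
  · rw [abs_le]; constructor <;> lia
  · simp [Pi.single_apply, hk]

/-- If no feasible point of the ray has an infeasible successor, the whole ray is feasible, which
rules out a positive entry of `A *ᵥ y`. -/
theorem ray_exits_or_recedes {A : Matrix (Fin m) (Fin n) ℤ} {b : Fin m → ℤ}
    {x : Fin n → ℤ} (y : Fin n → ℤ) (hx : A *ᵥ x ≤ b) :
    (∃ t : ℕ, A *ᵥ (x + (t : ℤ) • y) ≤ b ∧ ¬ A *ᵥ (x + (t : ℤ) • y + y) ≤ b) ∨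
      A *ᵥ y ≤ 0 := by
  by_contra! h
  obtain ⟨h1, h2⟩ := h
  have key : ∀ t : ℕ, A *ᵥ (x + (t : ℤ) • y) ≤ b := by
    intro t
    induction t with
    | zero => simpa using hx
    | succ t ih =>
      have := h1 t ih
      rwa [add_assoc, show (t : ℤ) • y + y = ((t + 1 : ℕ) : ℤ) • y by
        push_cast; rw [add_smul, one_smul]] at this
  simp only [Pi.le_def, not_forall, not_le] at h2
  obtain ⟨i, hi⟩ := h2
  have := key ((b i - (A *ᵥ x) i).toNat + 1) i
  simp only [mulVec_add, mulVec_smul, Pi.add_apply, Pi.smul_apply, smul_eq_mul,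
    Pi.zero_apply] at this hi
  have h3 : ((b i - (A *ᵥ x) i).toNat : ℤ) ≥ b i - (A *ᵥ x) i := Int.self_le_toNat _
  push_cast at this
  nlinarith

/-- A bounded recession direction along which the polynomial decreases without bound. -/
def Descends (A : Matrix (Fin m) (Fin n) ℤ) (b : Fin m → ℤ) (Q : Matrix (Fin n) (Fin n) ℤ)
    (q : Fin n → ℤ) (Y : ℤ) : Prop :=
  ∃ y : Fin n → ℤ, (∀ j, |y j| ≤ Y) ∧ A *ᵥ y ≤ 0 ∧ (y ⬝ᵥ Q *ᵥ y < 0 ∨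
    (y ⬝ᵥ Q *ᵥ y = 0 ∧ ∃ x, A *ᵥ x ≤ b ∧ slope Q q x y < 0))

theorem Descends.mono {A : Matrix (Fin m) (Fin n) ℤ} {b : Fin m → ℤ}
    {Q : Matrix (Fin n) (Fin n) ℤ} {q : Fin n → ℤ} {Y Y' : ℤ} (h : Descends A b Q q Y)
    (hY : Y ≤ Y') : Descends A b Q q Y' := by
  obtain ⟨y, hy, h⟩ := h
  exact ⟨y, fun j => (hy j).trans hY, h⟩

/-- A new bounded equation, satisfied by `x`, that is independent of those vanishing on `y`. -/
def NewRow (β : ι → ℤ) (Z : ℤ) (x y : Fin n → ℤ) : Prop :=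
  ∃ r : Fin n → ℤ, (∀ j, |r j| ≤ Z) ∧ Tame β Z (r ⬝ᵥ x) ∧ r ⬝ᵥ y ≠ 0

theorem abs_gradRow_le {Q : Matrix (Fin n) (Fin n) ℤ} {y : Fin n → ℤ} {Z Y : ℤ}
    (hQ : ∀ i j, |Q i j| ≤ Z) (hy : ∀ j, |y j| ≤ Y) (j : Fin n) :
    |gradRow Q y j| ≤ 2 * (n * (Z * Y)) := by
  have h1 : |(Q *ᵥ y) j| ≤ n * (Z * Y) := abs_dotProduct_le (hQ j) hy
  have h2 : |(y ᵥ* Q) j| ≤ n * (Y * Z) := abs_dotProduct_le hy (fun i => hQ i j)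
  have := abs_add_le ((Q *ᵥ y) j) ((y ᵥ* Q) j)
  rw [mul_comm Y] at h2
  simp only [gradRow, Pi.add_apply]
  linarith

theorem abs_quadForm_le {Q : Matrix (Fin n) (Fin n) ℤ} {x y : Fin n → ℤ} {Z X Y : ℤ}
    (hQ : ∀ i j, |Q i j| ≤ Z) (hx : ∀ j, |x j| ≤ X) (hy : ∀ j, |y j| ≤ Y) :
    |x ⬝ᵥ Q *ᵥ y| ≤ n * (X * (n * (Z * Y))) :=
  abs_dotProduct_le hx fun j => abs_dotProduct_le (hQ j) hy

theorem exists_min_along {A : Matrix (Fin m) (Fin n) ℤ} {b : Fin m → ℤ}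
    {Q : Matrix (Fin n) (Fin n) ℤ} {q x y : Fin n → ℤ} (hx : A *ᵥ x ≤ b)
    (ha : 0 < y ⬝ᵥ Q *ᵥ y) :
    ∃ t : ℤ, A *ᵥ (x + t • y) ≤ b ∧ ∀ t' : ℤ, A *ᵥ (x + t' • y) ≤ b →
      quad Q q (x + t • y) ≤ quad Q q (x + t' • y) := by
  obtain ⟨v, ⟨t, ht, rfl⟩, hmin⟩ := Int.exists_least_of_bdd
    (P := fun v => ∃ t : ℤ, A *ᵥ (x + t • y) ≤ b ∧ quad Q q (x + t • y) = v)
    -- With leading coefficient `a ≥ 1` and slope `s`, the change `t s + t² a` is at least `t s + t²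
    -- ≥ -s²`.
    ⟨quad Q q x - (slope Q q x y) ^ 2, by
      rintro v ⟨t, -, rfl⟩
      rw [quad_add_smul]
      nlinarith [sq_nonneg (2 * t + slope Q q x y), sq_nonneg t, sq_nonneg (slope Q q x y),
        mul_nonneg (sq_nonneg t) (show 0 ≤ y ⬝ᵥ Q *ᵥ y - 1 by lia)]⟩
    ⟨_, 0, by simpa using hx, rfl⟩
  exact ⟨t, ht, fun t' ht' => hmin _ ⟨t', ht', rfl⟩⟩

/-- Everything depends on the sign of `y ⬝ᵥ Q *ᵥ y`. If it is positive, the minimum on the line is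
either next to a wall or has a small derivative. Otherwise one orientation of `y` does not increase
the objective, and following it leads to a wall, to descent without bound, or to a line in the
polyhedron on which the objective is constant. -/
theorem step {A : Matrix (Fin m) (Fin n) ℤ} {b : Fin m → ℤ} {β : ι → ℤ}
    {Q : Matrix (Fin n) (Fin n) ℤ} {q : Fin n → ℤ} {Z Y : ℤ}
    (hβ : Covers A b β) (hn : (n : ℤ) ≤ Z) (hZ : 2 ≤ Z) (hY : 1 ≤ Y)
    (hA : ∀ i j, |A i j| ≤ Z) (hQ : ∀ i j, |Q i j| ≤ Z) (hq : ∀ j, |q j| ≤ Z)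
    {x y : Fin n → ℤ} (hy : ∀ j, |y j| ≤ Y) (hy0 : y ≠ 0) (hx : A *ᵥ x ≤ b) :
    Descends A b Q q Y ∨ ∃ t : ℤ, A *ᵥ (x + t • y) ≤ b ∧
      quad Q q (x + t • y) ≤ quad Q q x ∧ NewRow β (Z ^ 4 * Y ^ 2) (x + t • y) y := by
  have hn0 : (0 : ℤ) ≤ n := Int.natCast_nonneg n
  -- The bound `Z ^ 4 * Y ^ 2` has to absorb the entries of `A`, the slack at a wall, and the value
  -- of the gradient row.
  have hZY : Z ≤ Z ^ 4 * Y ^ 2 := by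
    have : 1 ≤ Y ^ 2 := one_le_pow₀ hY
    have : Z ^ 1 ≤ Z ^ 4 := pow_le_pow_right₀ (by lia) (by norm_num)
    nlinarith
  have hnZY : n * (Z * Y) + 1 ≤ Z ^ 4 * Y ^ 2 := by
    have h1 : (n : ℤ) * (Z * Y) ≤ Z * (Z * Y) := by gcongr
    have h2 : Z ^ 3 * Y ^ 1 ≤ Z ^ 4 * Y ^ 2 := by gcongr <;> lia
    have h3 : 1 ≤ Z * (Z * Y) := by nlinarith [mul_pos (show 0 < Z by lia) (show 0 < Y by lia)]
    nlinarith
  have hn2 : n * (Y * (n * (Z * Y))) + n * (Z * Y) ≤ Z ^ 4 * Y ^ 2 := by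
    have h1 : (n : ℤ) * (Y * (n * (Z * Y))) ≤ Z * (Y * (Z * (Z * Y))) := by gcongr
    have h2 : (n : ℤ) * (Z * Y) ≤ Z * (Z * Y) := by gcongr
    have h3 : Z * (Z * Y) ≤ Z ^ 3 * Y ^ 2 := by
      calc Z * (Z * Y) = Z ^ 2 * Y ^ 1 := by ring
        _ ≤ Z ^ 3 * Y ^ 2 := by gcongr <;> lia
    have h4 : 2 * (Z ^ 3 * Y ^ 2) ≤ Z * (Z ^ 3 * Y ^ 2) := by gcongr
    nlinarith
  -- leaving the polyhedron along `±y` yields a new row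
  have wall : ∀ s : ℤ, (s = 1 ∨ s = -1) → ∀ x', A *ᵥ x' ≤ b → ¬ A *ᵥ (x' + s • y) ≤ b →
      NewRow β (Z ^ 4 * Y ^ 2) x' y := by
    intro s hs x' hx' hx''
    have hsy : ∀ j, |(s • y) j| ≤ Y := by
      intro j
      rcases hs with rfl | rfl <;> simpa using hy j
    obtain ⟨i, hi, hi'⟩ := exists_wall hβ hA hsy hx' hx''
    refine ⟨A i, fun j => (hA i j).trans hZY, hi.mono hnZY, fun h => hi' ?_⟩
    rw [dotProduct_smul, h, smul_zero]
  by_cases ha : 0 < y ⬝ᵥ Q *ᵥ y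
  · right
    obtain ⟨t, ht, hmin⟩ := exists_min_along (q := q) hx ha
    refine ⟨t, ht, by simpa using hmin 0 (by simpa using hx), ?_⟩
    by_cases h1 : A *ᵥ (x + t • y + (1 : ℤ) • y) ≤ b
    swap
    · exact wall 1 (.inl rfl) _ ht h1
    by_cases h2 : A *ᵥ (x + t • y + (-1 : ℤ) • y) ≤ b
    swap
    · exact wall (-1) (.inr rfl) _ ht h2
    -- Both neighbours are feasible, so minimality bounds the slope in absolute value by `y ⬝ᵥ Q *ᵥ
    -- y`. Hence the gradient row has a small value at the minimum, and its value at `y` is `2 (y ⬝ᵥ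
    -- Q *ᵥ y) ≠ 0`.
    have m1 := hmin (t + 1) (by rwa [add_smul, ← add_assoc])
    have m2 := hmin (t + -1) (by rwa [add_smul, ← add_assoc])
    rw [add_smul, ← add_assoc, quad_add_smul _ _ (x + t • y)] at m1 m2
    have h3 := abs_le.1 (abs_quadForm_le hQ hy hy)
    have h4 := abs_le.1 (abs_dotProduct_le hq hy)
    refine ⟨gradRow Q y, fun j => (abs_gradRow_le hQ hy j).trans ?_, Tame.of_abs_le ?_, ?_⟩
    · have h1 : (n : ℤ) * (Z * Y) ≤ Z * (Z * Y) := by gcongr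
      have h2 : Z ^ 3 * Y ^ 1 ≤ Z ^ 4 * Y ^ 2 := by gcongr <;> lia
      have h3 : 2 * (Z * (Z * Y)) ≤ Z * (Z * (Z * Y)) := by gcongr
      nlinarith
    · have h5 : slope Q q (x + t • y) y = gradRow Q y ⬝ᵥ (x + t • y) + q ⬝ᵥ y := rfl
      rw [h5] at m1 m2
      rw [abs_le]
      constructor <;> linarith
    · rw [gradRow_dotProduct]
      lia
  · -- along a direction of nonincreasing values, run into a wall
    have run : ∀ s : ℤ, (s = 1 ∨ s = -1) → s * slope Q q x y ≤ 0 → ¬ A *ᵥ (s • y) ≤ 0 →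
        ∃ t : ℤ, A *ᵥ (x + t • y) ≤ b ∧ quad Q q (x + t • y) ≤ quad Q q x ∧
          NewRow β (Z ^ 4 * Y ^ 2) (x + t • y) y := by
      intro s hs hsl hns
      obtain ⟨t, ht, ht'⟩ := (ray_exits_or_recedes (s • y) hx).resolve_right hns
      rw [smul_smul] at ht ht'
      refine ⟨t * s, ht, ?_, wall s hs _ ht ht'⟩
      rw [quad_add_smul]
      have : (t : ℤ) * s * slope Q q x y ≤ 0 := by
        rw [mul_assoc]; exact mul_nonpos_of_nonneg_of_nonpos (by positivity) hsl
      nlinarith [sq_nonneg ((t : ℤ) * s)]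
    obtain ⟨s, hs, hsl⟩ : ∃ s : ℤ, (s = 1 ∨ s = -1) ∧ s * slope Q q x y ≤ 0 := by
      rcases le_total (slope Q q x y) 0 with h | h
      · exact ⟨1, .inl rfl, by lia⟩
      · exact ⟨-1, .inr rfl, by lia⟩
    by_cases hrec : A *ᵥ (s • y) ≤ 0
    swap
    · exact .inr (run s hs hsl hrec)
    have hss : s * s = 1 := by rcases hs with rfl | rfl <;> rfl
    have hquad : (s • y) ⬝ᵥ Q *ᵥ (s • y) = y ⬝ᵥ Q *ᵥ y := by
      rw [mulVec_smul, smul_dotProduct, dotProduct_smul, smul_smul, hss, one_smul]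
    have hslope : slope Q q x (s • y) = s * slope Q q x y := by
      rcases hs with rfl | rfl
      · simp
      · simp [slope_neg]
    have hsy : ∀ j, |(s • y) j| ≤ Y := by
      intro j
      rcases hs with rfl | rfl <;> simpa using hy j
    by_cases hneg : y ⬝ᵥ Q *ᵥ y < 0
    · exact .inl ⟨s • y, hsy, hrec, .inl (hquad ▸ hneg)⟩
    have ha0 : y ⬝ᵥ Q *ᵥ y = 0 := by lia
    by_cases hsl' : s * slope Q q x y < 0
    · exact .inl ⟨s • y, hsy, hrec, .inr ⟨hquad ▸ ha0, x, hx, hslope ▸ hsl'⟩⟩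
    have hs0 : slope Q q x y = 0 := by
      rcases hs with rfl | rfl <;> lia
    -- With zero curvature and zero slope the objective is constant on the line, so the opposite
    -- orientation may be followed as well.
    by_cases hrec' : A *ᵥ ((-s) • y) ≤ 0
    swap
    · exact .inr (run (-s) (by lia) (by simp [hs0]) hrec')
    have hAy : A *ᵥ y = 0 := by
      have h1 : A *ᵥ (s • y) = 0 := by
        refine le_antisymm hrec ?_
        rw [neg_smul, mulVec_neg] at hrec'
        exact neg_nonpos.1 hrec'
      rw [← one_smul ℤ y, ← hss, ← smul_smul, mulVec_smul, h1, smul_zero]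
    obtain ⟨j, hj⟩ := Function.ne_iff.1 hy0
    -- The whole line is feasible. Moving by the quotient replaces `x j` by its remainder modulo `y
    -- j ≠ 0`, so the unit row at `j` has a small value.
    refine .inr ⟨-(x j / y j), ?_, ?_, Pi.single j 1, fun l => ?_, Tame.of_abs_le ?_, ?_⟩
    · rw [mulVec_add, mulVec_smul, hAy, smul_zero, add_zero]; exact hx
    · rw [quad_add_smul, ha0, hs0]; simp
    · have : |(Pi.single j 1 : Fin n → ℤ) l| ≤ 1 := by
        by_cases h : l = j
        · subst h; simp
        · simp [h]
      lia
    · rw [single_dotProduct, one_mul]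
      have h1 : (x + -(x j / y j) • y) j = x j % y j := by
        simp only [Pi.add_apply, Pi.smul_apply, smul_eq_mul, Int.emod_def]; ring
      rw [h1, abs_of_nonneg (Int.emod_nonneg _ hj)]
      have h2 := Int.emod_lt_abs (x j) hj
      have h3 := hy j
      have h4 : 1 * Y ^ 1 ≤ Z ^ 4 * Y ^ 2 := by
        gcongr
        · exact one_le_pow₀ (by lia)
        · norm_num
      lia
    · simpa [single_dotProduct] using hj

/-- Siegel's lemma with a cruder bound that does not depend on the number of rows. -/
theorem exists_small_kernel_vector {k : ℕ} (hk : k < n) (E : Fin k → Fin n → ℤ) {Z : ℤ}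
    (hZ : 1 ≤ Z) (hn : (n : ℤ) ≤ Z) (hE : ∀ i j, |E i j| ≤ Z) :
    ∃ y : Fin n → ℤ, y ≠ 0 ∧ (∀ i, E i ⬝ᵥ y = 0) ∧ ∀ j, |y j| ≤ Z ^ (2 * n) := by
  have hZ1 : 1 ≤ Z ^ (2 * n) := one_le_pow₀ hZ
  rcases Nat.eq_zero_or_pos k with rfl | hk0
  · refine ⟨Pi.single ⟨0, hk⟩ 1, by simp, fun i => i.elim0, fun j => ?_⟩
    rw [Pi.single_apply]
    split_ifs <;> simp <;> lia
  obtain ⟨y, hy0, hy, hb⟩ := Int.Matrix.exists_ne_zero_int_vec_norm_le (Matrix.of E)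
    (by simpa using hk) (by simpa using hk0)
  refine ⟨y, hy0, fun i => congrFun hy i, fun j => ?_⟩
  let _ := Matrix.seminormedAddCommGroup (m := Fin k) (n := Fin n) (α := ℤ)
  have hZR : (1 : ℝ) ≤ Z := by exact_mod_cast hZ
  have hnorm : ‖Matrix.of E‖ ≤ (Z : ℝ) := by
    refine (Matrix.norm_le_iff (by linarith)).2 fun i j => ?_
    rw [Int.norm_eq_abs]
    exact_mod_cast hE i j
  have hn1 : (1 : ℝ) ≤ n := by exact_mod_cast (Nat.zero_lt_of_lt hk)
  have hnk : (1 : ℝ) ≤ n - k := by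
    have : (k : ℝ) + 1 ≤ n := by exact_mod_cast hk
    linarith
  have h1 : (1 : ℝ) ≤ n * max 1 ‖Matrix.of E‖ :=
    one_le_mul_of_one_le_of_one_le hn1 (le_max_left _ _)
  have h2 : (n : ℝ) * max 1 ‖Matrix.of E‖ ≤ Z ^ 2 := by
    rw [pow_two]
    have : (n : ℝ) ≤ Z := by exact_mod_cast hn
    exact mul_le_mul this (max_le hZR hnorm) (by positivity) (by linarith)
  have h3 : ‖y‖ ≤ (Z : ℝ) ^ (2 * n) := by
    refine hb.trans ?_
    simp only [Fintype.card_fin]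
    -- Siegel's exponent `k / (n - k)` is at most `n` because `n - k ≥ 1`.
    calc _ ≤ ((n : ℝ) * max 1 ‖Matrix.of E‖) ^ (n : ℝ) := by
          refine Real.rpow_le_rpow_of_exponent_le h1 ?_
          rw [div_le_iff₀ (by linarith)]
          have : (k : ℝ) ≤ n := by linarith
          nlinarith
      _ = ((n : ℝ) * max 1 ‖Matrix.of E‖) ^ n := Real.rpow_natCast _ _
      _ ≤ (Z ^ 2) ^ n := by gcongr
      _ = Z ^ (2 * n) := by rw [pow_mul]
  have h4 : ‖y j‖ ≤ (Z : ℝ) ^ (2 * n) := (norm_le_pi_norm y j).trans h3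
  rw [Int.norm_eq_abs] at h4
  exact_mod_cast h4

/-- Iterates `step`: a small vector orthogonal to the `k` rows found so far is a direction that
keeps their values, and the row gained from it is independent of them. -/
theorem exists_independent_rows {A : Matrix (Fin m) (Fin n) ℤ} {b : Fin m → ℤ} {β : ι → ℤ}
    {Q : Matrix (Fin n) (Fin n) ℤ} {q : Fin n → ℤ} {Z : ℤ}
    (hβ : Covers A b β) (hn : (n : ℤ) ≤ Z) (hZ : 2 ≤ Z)
    (hA : ∀ i j, |A i j| ≤ Z) (hQ : ∀ i j, |Q i j| ≤ Z) (hq : ∀ j, |q j| ≤ Z)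
    {x₀ : Fin n → ℤ} (hx₀ : A *ᵥ x₀ ≤ b) (k : ℕ) (hk : k ≤ n) :
    Descends A b Q q (Z ^ (4 * n + 4) ^ k) ∨ ∃ x, A *ᵥ x ≤ b ∧ quad Q q x ≤ quad Q q x₀ ∧
      ∃ E : Fin k → Fin n → ℤ, LinearIndependent ℤ E ∧
        (∀ i j, |E i j| ≤ Z ^ (4 * n + 4) ^ k) ∧
        ∀ i, Tame β (Z ^ (4 * n + 4) ^ k) (E i ⬝ᵥ x) := by
  induction k with
  | zero =>
    exact .inr ⟨x₀, hx₀, le_rfl, Fin.elim0, linearIndependent_empty_type, fun i => i.elim0,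
      fun i => i.elim0⟩
  | succ k ih =>
    set R := Z ^ (4 * n + 4) ^ k with hR
    have hR' : Z ^ (4 * n + 4) ^ (k + 1) = R ^ (4 * n + 4) := by
      rw [hR, ← pow_mul, pow_succ]
    have hZR : Z ≤ R := le_self_pow₀ (by lia) (by positivity)
    have hRR : R ≤ R ^ (4 * n + 4) := le_self_pow₀ (by lia) (by positivity)
    have hRY : R ^ (2 * n) ≤ R ^ (4 * n + 4) := pow_le_pow_right₀ (by lia) (by lia)
    rw [hR']
    rcases ih (by lia) with h | ⟨x, hx, hq', E, hE, hEb, hEt⟩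
    · exact .inl (h.mono hRR)
    obtain ⟨y, hy0, hEy, hyb⟩ := exists_small_kernel_vector (by lia) E (by lia) (hn.trans hZR) hEb
    rcases step hβ (hn.trans hZR) (hZ.trans hZR) (one_le_pow₀ (by lia))
      (fun i j => (hA i j).trans hZR) (fun i j => (hQ i j).trans hZR)
      (fun j => (hq j).trans hZR) hyb hy0 hx with h | ⟨t, ht, htq, r, hr, hrt, hry⟩
    · exact .inl (h.mono hRY)
    -- The row from `step` is bounded by `R ^ 4 * Y ^ 2` with `Y = R ^ (2 * n)` from Siegel's lemma;
    -- this is the source of the exponent `4 * n + 4`.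
    have hpow : R ^ 4 * (R ^ (2 * n)) ^ 2 = R ^ (4 * n + 4) := by ring
    rw [hpow] at hr hrt
    refine .inr ⟨x + t • y, ht, htq.trans hq', Fin.cons r E, ?_, ?_, ?_⟩
    -- Pairing with `y` annihilates the span of the old rows but not `r`.
    · refine LinearIndependent.finCons' _ _ hE fun c v hv hcv => ?_
      have hvy : ∀ v ∈ Submodule.span ℤ (Set.range E), v ⬝ᵥ y = 0 := by
        intro v hv
        induction hv using Submodule.span_induction with
        | mem v hv => obtain ⟨i, rfl⟩ := hv; exact hEy i
        | zero => exact zero_dotProduct _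
        | add v w _ _ h1 h2 => rw [add_dotProduct, h1, h2, add_zero]
        | smul a v _ h => rw [smul_dotProduct, h, smul_zero]
      have := congrArg (· ⬝ᵥ y) hcv
      simp only [add_dotProduct, smul_dotProduct, hvy v hv, zero_dotProduct, add_zero,
        smul_eq_mul] at this
      exact (mul_eq_zero.1 this).resolve_right hry
    · refine Fin.cases (fun j => by simpa using hr j) fun i j => ?_
      simpa using (hEb i j).trans hRR
    · refine Fin.cases (by simpa using hrt) fun i => ?_
      rw [Fin.cons_succ, dotProduct_add, dotProduct_smul, hEy, smul_zero, add_zero]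
      exact (hEt i).mono hRR

/-- `D x = ∑ k, β k • u k + w` for some small integers `D`, `u`, `w`. -/
def Candidate (β : ι → ℤ) (G : ℤ) (x : Fin n → ℤ) : Prop :=
  ∃ D : ℤ, 1 ≤ D ∧ D ≤ G ∧ ∀ j, Tame β G (D * x j)

theorem Candidate.mono {β : ι → ℤ} {G G' : ℤ} {x : Fin n → ℤ} (h : Candidate β G x)
    (hG : G ≤ G') : Candidate β G' x := by
  obtain ⟨D, h1, h2, h3⟩ := h
  exact ⟨D, h1, h2.trans hG, fun j => (h3 j).mono hG⟩

theorem Tame.sum_mul {β : ι → ℤ} {Z C : ℤ} {a c : Fin n → ℤ} (ha : ∀ i, |a i| ≤ C)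
    (hc : ∀ i, Tame β Z (c i)) : Tame β (n * (C * Z)) (∑ i, a i * c i) := by
  choose u w hu hw hc using hc
  refine ⟨fun k => a ⬝ᵥ fun i => u i k, a ⬝ᵥ w,
    fun k => abs_dotProduct_le ha fun i => hu i k, abs_dotProduct_le ha hw, ?_⟩
  simp only [hc, mul_add, Finset.sum_add_distrib, dotProduct, Finset.sum_mul, Finset.mul_sum]
  rw [Finset.sum_comm]
  simp only [mul_assoc]

theorem abs_det_le {M : Matrix (Fin n) (Fin n) ℤ} {Z : ℤ} (hn : (n : ℤ) ≤ Z) (hZ : 0 ≤ Z)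
    (hM : ∀ i j, |M i j| ≤ Z) : |M.det| ≤ Z ^ (2 * n) := by
  have h := Matrix.det_le (abv := AbsoluteValue.abs) (A := M) hM
  rw [Fintype.card_fin, nsmul_eq_mul] at h
  refine h.trans ?_
  have h1 : ((n.factorial : ℕ) : ℤ) ≤ (n : ℤ) ^ n := by exact_mod_cast Nat.factorial_le_pow n
  calc (n.factorial : ℤ) * Z ^ n ≤ Z ^ n * Z ^ n := by
        gcongr
        exact h1.trans (by gcongr)
    _ = Z ^ (2 * n) := by ring

/-- Cramer's rule: the determinant times `x` is the adjugate applied to the tame values, and the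
entries of the adjugate are determinants of small matrices. -/
theorem candidate_of_independent_rows {β : ι → ℤ} {Z : ℤ} (hn : (n : ℤ) ≤ Z) (hZ : 1 ≤ Z)
    {E : Fin n → Fin n → ℤ} (hE : LinearIndependent ℤ E) (hb : ∀ i j, |E i j| ≤ Z)
    {x : Fin n → ℤ} (ht : ∀ i, Tame β Z (E i ⬝ᵥ x)) :
    Candidate β (Z ^ (2 * n + 2)) x := by
  have hdet : (Matrix.of E).det ≠ 0 := by
    intro h
    obtain ⟨v, hv0, hv⟩ := Matrix.exists_vecMul_eq_zero_iff.2 h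
    refine hv0 (funext fun i => ?_)
    refine Fintype.linearIndependent_iff.1 hE v ?_ i
    rw [← hv, Matrix.vecMul_eq_sum]
    rfl
  have hle : Z ^ (2 * n) ≤ Z ^ (2 * n + 2) := pow_le_pow_right₀ hZ (by lia)
  have hadj : ∀ j i, |(Matrix.of E).adjugate j i| ≤ Z ^ (2 * n) := by
    intro j i
    rw [Matrix.adjugate_apply]
    refine abs_det_le hn (by lia) fun k l => ?_
    by_cases hk : k = i
    · subst hk
      rw [Matrix.updateRow_self, Pi.single_apply]
      split_ifs <;> simp <;> lia
    · rw [Matrix.updateRow_ne hk]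
      exact hb k l
  have hsol : ∀ j, (Matrix.of E).det * x j =
      ∑ i, (Matrix.of E).adjugate j i * (E i ⬝ᵥ x) := by
    intro j
    have h : (Matrix.of E).adjugate *ᵥ (Matrix.of E *ᵥ x) = (Matrix.of E).det • x := by
      rw [Matrix.mulVec_mulVec, Matrix.adjugate_mul, Matrix.smul_mulVec, Matrix.one_mulVec]
    exact (congrFun h j).symm
  -- The denominator has to be positive; the sign of the determinant goes into the coefficients.
  refine ⟨|(Matrix.of E).det|, Int.one_le_abs hdet,
    (abs_det_le hn (by lia) hb).trans hle, fun j => ?_⟩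
  have h1 : |(Matrix.of E).det| * x j =
      ∑ i, (SignType.sign (Matrix.of E).det * (Matrix.of E).adjugate j i) * (E i ⬝ᵥ x) := by
    simp only [mul_assoc]
    rw [← Finset.mul_sum, ← hsol, ← mul_assoc, sign_mul_self]
  rw [h1]
  refine (Tame.sum_mul (C := Z ^ (2 * n)) (fun i => ?_) ht).mono ?_
  · rw [abs_mul]
    have : |((SignType.sign (Matrix.of E).det : SignType) : ℤ)| ≤ 1 := by
      cases SignType.sign (Matrix.of E).det <;> simp
    calc _ ≤ 1 * Z ^ (2 * n) := by
          gcongr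
          exact hadj j i
      _ = _ := one_mul _
  · calc (n : ℤ) * (Z ^ (2 * n) * Z) ≤ Z * (Z ^ (2 * n) * Z) := by gcongr
      _ = Z ^ (2 * n + 2) := by ring

/-- The linear term `q` is kept general because the proof of `unbounded_or_candidates` also uses
this for linear objectives. -/
theorem descends_or_candidate {A : Matrix (Fin m) (Fin n) ℤ} {b : Fin m → ℤ} {β : ι → ℤ}
    {Q : Matrix (Fin n) (Fin n) ℤ} {q : Fin n → ℤ} {Z : ℤ}
    (hβ : Covers A b β) (hn : (n : ℤ) ≤ Z) (hZ : 2 ≤ Z)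
    (hA : ∀ i j, |A i j| ≤ Z) (hQ : ∀ i j, |Q i j| ≤ Z) (hq : ∀ j, |q j| ≤ Z)
    {x₀ : Fin n → ℤ} (hx₀ : A *ᵥ x₀ ≤ b) :
    Descends A b Q q (Z ^ (4 * n + 4) ^ n) ∨ ∃ x, A *ᵥ x ≤ b ∧ quad Q q x ≤ quad Q q x₀ ∧
      Candidate β (Z ^ ((4 * n + 4) ^ n * (2 * n + 2))) x := by
  refine (exists_independent_rows hβ hn hZ hA hQ hq hx₀ n le_rfl).imp_right ?_
  rintro ⟨x, hx, hxq, E, hE, hEb, hEt⟩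
  have hZR : Z ≤ Z ^ (4 * n + 4) ^ n := le_self_pow₀ (by lia) (by positivity)
  refine ⟨x, hx, hxq, ?_⟩
  rw [pow_mul]
  exact candidate_of_independent_rows (hn.trans hZR) (by lia) hE hEb hEt

/-- The exponent of the bound on the coefficients of candidates and directions. -/
def boundExp (n : ℕ) : ℕ := ((4 * n + 4) ^ n + 5) * ((4 * n + 4) ^ n + 5) * (2 * n + 2)

/-- Either there are a feasible candidate and a small direction that prove the program unbounded,
or every feasible solution is at most as good as a feasible candidate. -/
theorem unbounded_or_candidates {A : Matrix (Fin m) (Fin n) ℤ} {b : Fin m → ℤ} {β : ι → ℤ}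
    {Q : Matrix (Fin n) (Fin n) ℤ} {Z : ℤ}
    (hβ : Covers A b β) (hn : (n : ℤ) ≤ Z) (hZ : 2 ≤ Z)
    (hA : ∀ i j, |A i j| ≤ Z) (hQ : ∀ i j, |Q i j| ≤ Z)
    {x₀ : Fin n → ℤ} (hx₀ : A *ᵥ x₀ ≤ b) :
    (∃ x y : Fin n → ℤ, Candidate β (Z ^ boundExp n) x ∧ A *ᵥ x ≤ b ∧
      (∀ j, |y j| ≤ Z ^ boundExp n) ∧ A *ᵥ y ≤ 0 ∧
      (y ⬝ᵥ Q *ᵥ y < 0 ∨ (y ⬝ᵥ Q *ᵥ y = 0 ∧ slope Q 0 x y < 0))) ∨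
    ∃ x, A *ᵥ x ≤ b ∧ Candidate β (Z ^ boundExp n) x ∧ x ⬝ᵥ Q *ᵥ x ≤ x₀ ⬝ᵥ Q *ᵥ x₀ := by
  set e := (4 * n + 4) ^ n with he
  have hZ1 : (1 : ℤ) ≤ Z := by lia
  have hB : boundExp n = (e + 5) * (e + 5) * (2 * n + 2) := rfl
  have he1 : (e + 5) * (e + 5) * 2 ≤ boundExp n := by
    rw [hB]; gcongr; lia
  have hle1 : Z ^ e ≤ Z ^ boundExp n := pow_le_pow_right₀ hZ1 (by nlinarith)
  have hle2 : Z ^ (e * (2 * n + 2)) ≤ Z ^ boundExp n :=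
    pow_le_pow_right₀ hZ1 (by rw [hB]; gcongr; nlinarith)
  have hle3 : (Z ^ (3 + e)) ^ (e * (2 * n + 2)) ≤ Z ^ boundExp n := by
    rw [← pow_mul]
    refine pow_le_pow_right₀ hZ1 ?_
    rw [hB, ← mul_assoc]
    exact Nat.mul_le_mul_right _ (Nat.mul_le_mul (by lia) (by lia))
  -- Nothing descends for the zero objective, so this run supplies a feasible candidate to serve as
  -- base point.
  obtain ⟨xc, hxc, -, hxcc⟩ := (descends_or_candidate (Q := 0) (q := 0) hβ hn hZ hA
    (by simp; lia) (by simp; lia) hx₀).resolve_left (by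
      rintro ⟨y, -, -, h | ⟨-, x, -, h⟩⟩ <;> simp [slope, gradRow] at h)
  rcases descends_or_candidate (q := 0) hβ hn hZ hA hQ (by simp; lia) hx₀ with
    ⟨y, hyb, hy, h | ⟨hyy, x, hx, hs⟩⟩ | ⟨x, hx, hxq, hxc⟩
  · exact .inl ⟨xc, y, hxcc.mono hle2, hxc, fun j => (hyb j).trans hle1, hy, .inl h⟩
  -- The point `x` with negative slope need not be a candidate. Minimizing the linear form `gradRow
  -- Q y` instead gives a candidate with slope at most that of `x`, or a recession direction `z` on
  -- which the form is negative.
  · have hZR : Z ≤ Z ^ (3 + e) := le_self_pow₀ hZ1 (by lia)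
    have hgb : ∀ j, |gradRow Q y j| ≤ Z ^ (3 + e) := by
      intro j
      refine (abs_gradRow_le hQ hyb j).trans ?_
      calc 2 * (n * (Z * Z ^ e)) ≤ Z * (Z * (Z * Z ^ e)) := by gcongr
        _ = Z ^ (3 + e) := by ring
    have hs' : gradRow Q y ⬝ᵥ x < 0 := by simpa [slope] using hs
    rcases descends_or_candidate (Q := 0) (q := gradRow Q y) hβ (hn.trans hZR) (hZ.trans hZR)
      (fun i j => (hA i j).trans hZR) (by intros; simp; lia) hgb hx with
      ⟨z, hzb, hz, h | ⟨-, w, -, h⟩⟩ | ⟨x', hx', hxq, hxc'⟩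
    · simp at h
    · have h' : gradRow Q y ⬝ᵥ z < 0 := by simpa [slope, gradRow] using h
      have hzz := abs_quadForm_le hQ hzb hzb
      rw [← pow_mul] at hzb hzz
      -- Put `N = |z ⬝ᵥ Q *ᵥ z| + 1`. Since the form vanishes at `y`, its value at `N y + z` is `N
      -- (gradRow Q y ⬝ᵥ z) + z ⬝ᵥ Q *ᵥ z ≤ -N + z ⬝ᵥ Q *ᵥ z < 0`.
      refine .inl ⟨xc, (|z ⬝ᵥ Q *ᵥ z| + 1) • y + z, hxcc.mono hle2, hxc, fun j => ?_, ?_, .inl ?_⟩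
      · set F := Z ^ ((3 + e) * e) with hF
        have hF1 : 1 ≤ F := one_le_pow₀ hZ1
        have hE1 : 1 ≤ Z ^ e := one_le_pow₀ hZ1
        have h0 : n * (F * (n * (Z * F))) ≤ Z ^ 3 * F ^ 2 := by
          calc n * (F * (n * (Z * F))) ≤ Z * (F * (Z * (Z * F))) := by gcongr
            _ = Z ^ 3 * F ^ 2 := by ring
        have h3 : 1 ≤ Z ^ 3 * F ^ 2 := by
          have := one_le_pow₀ (n := 3) hZ1
          have := one_le_pow₀ (n := 2) hF1
          nlinarith
        have h4 : F ≤ Z ^ 3 * F ^ 2 * Z ^ e := by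
          have := one_le_pow₀ (n := 3) hZ1
          calc F = 1 * F ^ 1 * 1 := by ring
            _ ≤ Z ^ 3 * F ^ 2 * Z ^ e := by gcongr; norm_num
        calc |((|z ⬝ᵥ Q *ᵥ z| + 1) • y + z) j|
            ≤ (|z ⬝ᵥ Q *ᵥ z| + 1) * |y j| + |z j| := by
              refine (abs_add_le _ _).trans ?_
              rw [Pi.smul_apply, smul_eq_mul, abs_mul,
                abs_of_nonneg (a := |z ⬝ᵥ Q *ᵥ z| + 1) (by positivity)]
          _ ≤ (Z ^ 3 * F ^ 2 + Z ^ 3 * F ^ 2) * Z ^ e + F := by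
              gcongr
              · exact hzz.trans h0
              · exact hyb j
              · exact hzb j
          _ ≤ 2 * 2 * (Z ^ 3 * F ^ 2 * Z ^ e) := by linarith
          _ ≤ Z * Z * (Z ^ 3 * F ^ 2 * Z ^ e) := by gcongr
          _ = Z ^ (5 + 2 * ((3 + e) * e) + e) := by rw [hF]; ring
          _ ≤ Z ^ boundExp n := pow_le_pow_right₀ hZ1 (by nlinarith)
      · rw [mulVec_add, mulVec_smul]
        intro i
        have h1 := hy i
        have h2 := hz i
        simp only [Pi.zero_apply, Pi.add_apply, Pi.smul_apply, smul_eq_mul] at h1 h2 ⊢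
        nlinarith [abs_nonneg (z ⬝ᵥ Q *ᵥ z)]
      · rw [gradRow_dotProduct] at h'
        simp only [mulVec_add, mulVec_smul, dotProduct_add, add_dotProduct, smul_dotProduct,
          dotProduct_smul, smul_eq_mul, hyy]
        nlinarith [abs_nonneg (z ⬝ᵥ Q *ᵥ z), le_abs_self (z ⬝ᵥ Q *ᵥ z)]
    · refine .inl ⟨x', y, hxc'.mono hle3, hx', fun j => (hyb j).trans hle1, hy, .inr ⟨hyy, ?_⟩⟩
      have : gradRow Q y ⬝ᵥ x' ≤ gradRow Q y ⬝ᵥ x := by simpa [quad] using hxq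
      simpa [slope] using this.trans_lt hs'
  · exact .inr ⟨x, hx, hxc.mono hle2, by simpa [quad] using hxq⟩

end Descent

end IQP

/-! ### Code combinators with bounds on values and times -/

namespace RAM

theorem bitLen_le_of_abs_le {z : ℤ} {k : ℕ} (h : |z| ≤ 2 ^ k) : bitLen z ≤ k + 2 := by
  have h1 : z.natAbs < 2 ^ (k + 1) := by
    have : (z.natAbs : ℤ) ≤ 2 ^ k := by rwa [Int.natCast_natAbs]
    have h2 : z.natAbs ≤ 2 ^ k := by exact_mod_cast this
    have : 2 ^ k < 2 ^ (k + 1) := Nat.pow_lt_pow_right (by norm_num) (by lia)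
    lia
  have := Nat.size_le.2 h1
  unfold bitLen
  lia

/-- `U` and `W` are units for measuring values and running times. -/
structure Units (U W : ℕ) : Prop where
  two_le : 2 ≤ U
  four_le : 4 ≤ W
  size_le : Nat.size U ≤ W

theorem mul_le_pow_add {W x y a b : ℕ} (hx : x ≤ W ^ a) (hy : y ≤ W ^ b) :
    x * y ≤ W ^ (a + b) := by
  rw [pow_add]; exact Nat.mul_le_mul hx hy

namespace Units

variable {U W : ℕ} (h : Units U W)
include h

/-- The link between the two units: `U ^ a` has at most about `a * W` bits, which a power of `W`
absorbs. -/
theorem bitLen_le {z : ℤ} {a : ℕ} (hz : |z| ≤ U ^ a) : bitLen z ≤ W ^ (a + 1) := by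
  have h1 : |z| ≤ 2 ^ (a * W) := by
    refine hz.trans ?_
    have h2 : U ≤ 2 ^ W := by
      have := Nat.size_le.1 h.size_le
      lia
    calc (U : ℤ) ^ a ≤ (2 ^ W) ^ a := by
          gcongr
          exact_mod_cast h2
      _ = 2 ^ (a * W) := by rw [← pow_mul, mul_comm]
  have h3 := bitLen_le_of_abs_le h1
  have h4 : a + 1 ≤ W ^ a := Nat.lt_pow_self (by have := h.four_le; lia)
  have h5 := h.four_le
  rw [pow_succ]
  nlinarith

theorem one_le_pow (a : ℕ) : 1 ≤ W ^ a := Nat.one_le_pow _ _ (by have := h.four_le; lia)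

/-- Crude on purpose: every cost is a single power of `W`, so cost bounds compose by adding
exponents. -/
theorem add_le {x y a b : ℕ} (hx : x ≤ W ^ a) (hy : y ≤ W ^ b) : x + y ≤ W ^ (a + b + 1) := by
  have h1 := h.one_le_pow a
  have h2 := h.one_le_pow b
  have h3 := h.four_le
  have h4 : W ^ a * W ^ b * 4 ≤ W ^ a * W ^ b * W := by gcongr
  rw [pow_succ, pow_add]
  nlinarith

theorem pow_mono {a b : ℕ} (hab : a ≤ b) : W ^ a ≤ W ^ b :=
  Nat.pow_le_pow_right (by have := h.four_le; lia) hab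

theorem value_mono {a b : ℕ} (hab : a ≤ b) : (U : ℤ) ^ a ≤ U ^ b :=
  pow_le_pow_right₀ (by have := h.two_le; lia) hab

theorem abs_add_le {x y : ℤ} {a b : ℕ} (hx : |x| ≤ U ^ a) (hy : |y| ≤ U ^ b) :
    |x + y| ≤ U ^ (a + b + 1) := by
  have h1 := h.value_mono (show a ≤ a + b by lia)
  have h2 := h.value_mono (show b ≤ a + b by lia)
  have h3 : (2 : ℤ) ≤ U := by exact_mod_cast h.two_le
  have h4 := _root_.abs_add_le x y
  have h5 : (0 : ℤ) ≤ U ^ (a + b) := by positivity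
  rw [pow_succ]
  nlinarith

end Units

/-- The code for a term, depending on the first register that it may overwrite; this is also where
it leaves its value. -/
abbrev Code := ℕ → Prog

/-- `s'` has the arrays of `s` and its registers below `d`. -/
def Agree (d : ℕ) (s s' : State) : Prop := s'.arr = s.arr ∧ ∀ x < d, s'.reg x = s.reg x

theorem Agree.refl (d : ℕ) (s : State) : Agree d s s := ⟨rfl, fun _ _ => rfl⟩

theorem Agree.trans {d d' : ℕ} {s s' s'' : State} (h : Agree d s s') (h' : Agree d' s' s'')
    (hd : d ≤ d') : Agree d s s'' :=
  ⟨h'.1.trans h.1, fun x hx => (h'.2 x (by lia)).trans (h.2 x hx)⟩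

theorem Agree.setReg {d : ℕ} {s s' : State} (h : Agree d s s') {x : ℕ} (hx : d ≤ x) (v : ℤ) :
    Agree d s (s'.setReg x v) := by
  refine ⟨h.1, fun y hy => ?_⟩
  simp only [State.setReg]
  rw [Function.update_of_ne (by lia)]
  exact h.2 y hy

@[simp]
theorem State.reg_setReg_self (s : State) (x : ℕ) (v : ℤ) : (s.setReg x v).reg x = v := by
  simp [State.setReg]

theorem State.reg_setReg_of_ne (s : State) {x y : ℕ} (v : ℤ) (h : y ≠ x) :
    (s.setReg x v).reg y = s.reg y := by
  simp [State.setReg, h]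

/-- In states that agree with `s` below `d`, the code `p` computes `v`, of absolute value at most
`U ^ a`, in time `W ^ e`. -/
structure Computes (U W a e d : ℕ) (p : Code) (s : State) (v : ℤ) : Prop where
  abs_le : |v| ≤ U ^ a
  exec : ∀ s', Agree d s s' → ∃ s'' t, Exec (p d) s' s'' t ∧ t ≤ W ^ e ∧ Agree d s s'' ∧
    s''.reg d = v

section Combinators

variable {U W : ℕ}

theorem Computes.mono (h : Units U W) {a a' e e' d : ℕ} {p : Code} {s : State} {v : ℤ}
    (hp : Computes U W a e d p s v) (ha : |v| ≤ U ^ a') (he : e ≤ e') :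
    Computes U W a' e' d p s v := by
  refine ⟨ha, fun s' hs => ?_⟩
  obtain ⟨s'', t, h1, h2, h3⟩ := hp.exec s' hs
  exact ⟨s'', t, h1, h2.trans (h.pow_mono he), h3⟩

namespace Code

/-- A constant. -/
def lit (c : ℤ) : Code := fun d => .const d c

/-- The contents of a register. -/
def var (r : ℕ) : Code := fun d => .seq (.const d 0) (.arith .add d r d)

/-- A cell of the array `k`. -/
def get (k : ℕ) (p : Code) : Code := fun d => .seq (p d) (.load d k d)

/-- An arithmetic operation. -/
def bin (o : Op) (p q : Code) : Code := fun d =>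
  .seq (p d) (.seq (q (d + 1)) (.arith o d d (d + 1)))

/-- Case distinction on the sign of `c`. -/
def cond (c p q : Code) : Code := fun d => .seq (c d) (.ite d (p d) (q d))

/-- Iteration: `body a i` computes the next value of the accumulator from the accumulator in
register `a` and the counter in register `i`. -/
def fold (init lim : Code) (body : ℕ → ℕ → Code) : Code := fun d =>
  .seq (init d) (.seq (.const (d + 1) 0) (.seq (lim (d + 2)) (.loop (d + 2)
    (.seq (body d (d + 1) (d + 3)) (.seq (.const (d + 4) 0) (.seq (.arith .add d (d + 3) (d + 4))
      (.seq (.const (d + 3) 1) (.seq (.arith .add (d + 1) (d + 1) (d + 3))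
        (.arith .sub (d + 2) (d + 2) (d + 3))))))))))

end Code

theorem Computes.lit (h : Units U W) {c : ℤ} {a : ℕ} (hc : |c| ≤ U ^ a) (d : ℕ) (s : State) :
    Computes U W a (a + 2) d (.lit c) s c := by
  refine ⟨hc, fun s' hs => ⟨_, _, .const _ _ _, ?_, hs.setReg le_rfl _, by simp⟩⟩
  have := h.add_le (h.one_le_pow 0) (h.bitLen_le hc)
  exact this.trans (h.pow_mono (by lia))

theorem Computes.var (h : Units U W) {r a d : ℕ} {s : State} (hr : r < d) {v : ℤ}
    (hv : s.reg r = v) (ha : |v| ≤ U ^ a) : Computes U W a (a + 3) d (.var r) s v := by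
  refine ⟨ha, fun s' hs => ⟨_, _, .seq (.const _ _ _) (.arith _ _ _ _ _), ?_,
    (hs.setReg le_rfl _).setReg le_rfl _, ?_⟩⟩
  · rw [State.reg_setReg_self, State.reg_setReg_of_ne _ _ hr.ne, hs.2 r hr, hv]
    have h1 := h.bitLen_le ha
    have h2 := h.four_le
    have h3 : bitLen 0 = 1 := rfl
    rw [h3]
    have h4 := h.add_le (h2.trans_eq (pow_one W).symm) h1
    exact le_trans (by lia) (h4.trans (h.pow_mono (by lia)))
  · rw [State.reg_setReg_self, State.reg_setReg_self, State.reg_setReg_of_ne _ _ hr.ne, hs.2 r hr,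
      hv]
    simp [Op.apply]

theorem Computes.get (h : Units U W) {k a b e d : ℕ} {p : Code} {s : State} {v w : ℤ}
    (hp : Computes U W a e d p s v) (hw : s.arr k v = w) (hb : |w| ≤ U ^ b) :
    Computes U W b (a + b + e + 6) d (.get k p) s w := by
  refine ⟨hb, fun s' hs => ?_⟩
  obtain ⟨s₁, t, h1, h2, h3, h4⟩ := hp.exec s' hs
  refine ⟨_, _, .seq h1 (.load _ _ _ _), ?_, h3.setReg le_rfl _, ?_⟩
  · rw [h4, h3.1, hw]
    have := h.add_le h2 (h.add_le (h.add_le (h.one_le_pow 0) (h.bitLen_le hp.abs_le))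
      (h.bitLen_le hb))
    exact this.trans (h.pow_mono (by lia))
  · rw [State.reg_setReg_self, h4, h3.1, hw]

/-- The second operand runs one register higher and thus preserves the first. Its specification is
required in every state agreeing with `s` below `d`, because register `d` now holds the first value.
-/
theorem Computes.bin (h : Units U W) {a b c e f d : ℕ} {o : Op} {p q : Code} {s : State}
    {v w : ℤ} (hp : Computes U W a e d p s v)
    (hq : ∀ s', Agree d s s' → Computes U W b f (d + 1) q s' w)
    (hc : |o.apply v w| ≤ U ^ c) :
    Computes U W c (a + b + e + f + 8) d (.bin o p q) s (o.apply v w) := by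
  refine ⟨hc, fun s' hs => ?_⟩
  obtain ⟨s₁, t, h1, h2, h3, h4⟩ := hp.exec s' hs
  obtain ⟨s₂, t', h1', h2', h3', h4'⟩ := (hq s₁ h3).exec s₁ (.refl _ _)
  refine ⟨_, _, .seq h1 (.seq h1' (.arith _ _ _ _ _)), ?_,
    (h3.trans h3' (by lia)).setReg le_rfl _, ?_⟩
  · rw [h4', h3'.2 d (by lia), h4]
    have := h.add_le h2 (h.add_le h2' (h.add_le (h.add_le (h.one_le_pow 0)
      (h.bitLen_le hp.abs_le)) (h.bitLen_le (hq s₁ h3).abs_le)))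
    exact this.trans (h.pow_mono (by lia))
  · rw [State.reg_setReg_self, h4', h3'.2 d (by lia), h4]

theorem Computes.cond (h : Units U W) {a b e f g d : ℕ} {c p q : Code} {s : State}
    {v w : ℤ} (hc : Computes U W a e d c s v)
    (hp : 0 < v → ∀ s', Agree d s s' → Computes U W b f d p s' w)
    (hq : ¬ 0 < v → ∀ s', Agree d s s' → Computes U W b g d q s' w) :
    Computes U W b (a + e + f + g + 6) d (.cond c p q) s w := by
  have hb : |w| ≤ U ^ b := by
    by_cases hv : 0 < v
    · exact (hp hv s (.refl _ _)).abs_le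
    · exact (hq hv s (.refl _ _)).abs_le
  refine ⟨hb, fun s' hs => ?_⟩
  obtain ⟨s₁, t, h1, h2, h3, h4⟩ := hc.exec s' hs
  by_cases hv : 0 < v
  · obtain ⟨s₂, t', h1', h2', h3', h4'⟩ := (hp hv s₁ h3).exec s₁ (.refl _ _)
    refine ⟨_, _, .seq h1 (.ite_pos (by rwa [h4]) h1'), ?_, h3.trans h3' le_rfl, h4'⟩
    rw [h4]
    have := h.add_le h2 (h.add_le (h.add_le (h.one_le_pow 0) (h.bitLen_le hc.abs_le)) h2')
    exact this.trans (h.pow_mono (by lia))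
  · obtain ⟨s₂, t', h1', h2', h3', h4'⟩ := (hq hv s₁ h3).exec s₁ (.refl _ _)
    refine ⟨_, _, .seq h1 (.ite_neg (by rwa [h4]) h1'), ?_, h3.trans h3' le_rfl, h4'⟩
    rw [h4]
    have := h.add_le h2 (h.add_le (h.add_le (h.one_le_pow 0) (h.bitLen_le hc.abs_le)) h2')
    exact this.trans (h.pow_mono (by lia))

/-- Time for one round of a counting loop. -/
theorem Units.round_le (h : Units U W) {a b e x y z t : ℕ} (hx : x ≤ W ^ (b + 1))
    (hy : y ≤ W ^ (b + 1)) (hz : z ≤ W ^ (a + 1)) (ht : t ≤ W ^ e) :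
    20 + 2 * x + y + z + t ≤ W ^ (a + b + e + 5) := by
  have h0 := h.four_le
  have h1 : W ^ (b + 1) ≤ W ^ (a + b + e + 1) := h.pow_mono (by lia)
  have h2 : W ^ (a + 1) ≤ W ^ (a + b + e + 1) := h.pow_mono (by lia)
  have h3 : W ^ e ≤ W ^ (a + b + e + 1) := h.pow_mono (by lia)
  have h4 : W ≤ W ^ (a + b + e + 1) := Nat.le_self_pow (by lia) _
  have h5 : W ^ (a + b + e + 1) * (4 * 4) ≤ W ^ (a + b + e + 1) * (W * W) := by gcongr
  have h6 : W ^ (a + b + e + 1) * (W * W) = W ^ (a + b + e + 3) := by ring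
  have h7 : W ^ (a + b + e + 3) ≤ W ^ (a + b + e + 5) := h.pow_mono (by lia)
  lia

/-- All accumulator values satisfy the same bound `U ^ a`, so the exponents do not grow with the
number of rounds. Registers `d`, `d + 1` and `d + 2` hold the accumulator, the counter and the
number of remaining rounds. -/
theorem Computes.fold (h : Units U W) {a b e₀ e₁ e f d : ℕ} {init lim : Code}
    {body : ℕ → ℕ → Code} {s : State} {N : ℕ} {v : ℕ → ℤ} (hN : N ≤ W ^ f)
    (hinit : Computes U W a e₀ d init s (v 0))
    (hlim : ∀ s', Agree d s s' → Computes U W b e₁ (d + 2) lim s' N)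
    (hbody : ∀ j < N, ∀ s', Agree d s s' → s'.reg d = v j → s'.reg (d + 1) = j →
      Computes U W a e (d + 3) (body d (d + 1)) s' (v (j + 1))) :
    Computes U W a (a + b + e₀ + e₁ + e + f + 15) d (.fold init lim body) s (v N) := by
  -- The bound on each value is read off from the specification of the body in a state made up for
  -- this purpose.
  have hv : ∀ j ≤ N, |v j| ≤ U ^ a := by
    intro j hj
    rcases j with _ | j
    · exact hinit.abs_le
    · refine (hbody j (by lia) ((s.setReg d (v j)).setReg (d + 1) j)
        (((Agree.refl d s).setReg le_rfl _).setReg (by lia) _) ?_ ?_).abs_le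
      · rw [State.reg_setReg_of_ne _ _ (by lia), State.reg_setReg_self]
      · rw [State.reg_setReg_self]
  have hNb : |(N : ℤ)| ≤ U ^ b := (hlim s (.refl _ _)).abs_le
  have hlt : ∀ j : ℕ, j ≤ N → bitLen j ≤ W ^ (b + 1) := fun j hj =>
    h.bitLen_le (le_trans (by rw [Nat.abs_cast, Nat.abs_cast]; exact_mod_cast hj) hNb)
  have hloop : ∀ r j : ℕ, j + r = N → ∀ s₁, Agree d s s₁ → s₁.reg d = v j →
      s₁.reg (d + 1) = j → s₁.reg (d + 2) = r → ∃ s₂ t, Exec (.loop (d + 2)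
        (.seq (body d (d + 1) (d + 3)) (.seq (.const (d + 4) 0)
          (.seq (.arith .add d (d + 3) (d + 4)) (.seq (.const (d + 3) 1)
            (.seq (.arith .add (d + 1) (d + 1) (d + 3))
              (.arith .sub (d + 2) (d + 2) (d + 3)))))))) s₁ s₂ t ∧
        t ≤ (r + 1) * W ^ (a + b + e + 5) ∧ Agree d s s₂ ∧ s₂.reg d = v N := by
    intro r
    induction r with
    | zero =>
      intro j hj s₁ hs₁ hd _ hd2
      refine ⟨s₁, _, .loop_done (by simp [hd2]), ?_, hs₁, by rw [hd, ← hj, add_zero]⟩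
      rw [hd2]
      have h3 : bitLen ((0 : ℕ) : ℤ) = 1 := rfl
      have h4 : W ≤ W ^ (a + b + e + 5) := Nat.le_self_pow (by lia) _
      have := h.four_le
      lia
    | succ r ih =>
      intro j hj s₁ hs₁ hd hd1 hd2
      obtain ⟨s₂, t, hx, ht, hag, hres⟩ :=
        (hbody j (by lia) s₁ hs₁ hd hd1).exec s₁ (.refl _ _)
      have e1 : s₂.reg (d + 1) = j := (hag.2 _ (by lia)).trans hd1
      have e2 : s₂.reg (d + 2) = (r + 1 : ℕ) := (hag.2 _ (by lia)).trans hd2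
      let s₃ := s₂.setReg (d + 4) 0
      let s₄ := s₃.setReg d (Op.add.apply (s₃.reg (d + 3)) (s₃.reg (d + 4)))
      let s₅ := s₄.setReg (d + 3) 1
      let s₆ := s₅.setReg (d + 1) (Op.add.apply (s₅.reg (d + 1)) (s₅.reg (d + 3)))
      let s₇ := s₆.setReg (d + 2) (Op.sub.apply (s₆.reg (d + 2)) (s₆.reg (d + 3)))
      have r3 : s₃.reg (d + 3) = v (j + 1) := by
        simp [s₃, State.setReg, Function.update, hres]
      have r4 : s₃.reg (d + 4) = 0 := by simp [s₃]
      have r51 : s₅.reg (d + 1) = j := by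
        simp [s₃, s₄, s₅, State.setReg, Function.update, e1]
      have r53 : s₅.reg (d + 3) = 1 := by simp [s₅]
      have r62 : s₆.reg (d + 2) = (r + 1 : ℕ) := by
        simp [s₃, s₄, s₅, s₆, State.setReg, Function.update, e2]
      have r63 : s₆.reg (d + 3) = 1 := by
        simp [s₅, s₆, State.setReg, Function.update]
      have r7 : s₇.reg d = v (j + 1) := by
        simp [s₃, s₄, s₅, s₆, s₇, State.setReg, Function.update, hres, Op.apply]
      have r71 : s₇.reg (d + 1) = (j + 1 : ℕ) := by
        simp [s₃, s₄, s₅, s₆, s₇, State.setReg, Function.update, e1, Op.apply]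
      have r72 : s₇.reg (d + 2) = r := by
        simp only [s₇, State.reg_setReg_self, r62, r63, Op.apply]
        push_cast
        ring
      have hag7 : Agree d s s₇ :=
        (((((hs₁.trans hag (by lia)).setReg (by lia) _).setReg le_rfl _).setReg
          (by lia) _).setReg (by lia) _).setReg (by lia) _
      obtain ⟨s₈, t', hx', ht', hag', hres'⟩ := ih (j + 1) (by lia) s₇ hag7 r7 r71 r72
      refine ⟨s₈, _, .loop_step (by rw [hd2]; positivity) (.seq hx (.seq (.const _ _ _)
        (.seq (.arith s₃ _ _ _ _) (.seq (.const s₄ _ _) (.seq (.arith s₅ _ _ _ _)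
          (.arith s₆ _ _ _ _)))))) hx', ?_, hag', hres'⟩
      rw [r3, r4, r51, r53, r62, r63, hd2]
      have h3 : bitLen (0 : ℤ) = 1 := rfl
      have h4 : bitLen (1 : ℤ) = 2 := rfl
      have h5 := h.round_le (hlt (r + 1) (by lia)) (hlt j (by lia))
        (h.bitLen_le (hv (j + 1) (by lia))) ht
      rw [h3, h4, add_mul (r + 1), one_mul]
      lia
  refine ⟨hv N le_rfl, fun s' hs => ?_⟩
  obtain ⟨s₁, t₁, x1, l1, a1, q1⟩ := hinit.exec s' hs
  obtain ⟨s₂, t₂, x2, l2, a2, q2⟩ := (hlim _ (a1.setReg (show d ≤ d + 1 by lia) 0)).exec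
    (s₁.setReg (d + 1) 0) (.refl _ _)
  obtain ⟨s₃, t₃, x3, l3, a3, q3⟩ := hloop N 0 (by lia) s₂
    ((a1.setReg (show d ≤ d + 1 by lia) 0).trans a2 (by lia))
    (by rw [a2.2 d (by lia), State.reg_setReg_of_ne _ _ (by lia), q1])
    (by rw [a2.2 (d + 1) (by lia), State.reg_setReg_self]; rfl) q2
  refine ⟨s₃, _, .seq x1 (.seq (.const _ _ _) (.seq x2 x3)), ?_, a3, q3⟩
  have h3 : 1 + bitLen (0 : ℤ) ≤ W ^ 1 := by
    have : bitLen (0 : ℤ) = 1 := rfl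
    have := h.four_le
    rw [pow_one]
    lia
  have h4 : N + 1 ≤ W ^ (f + 0 + 1) := h.add_le hN (h.one_le_pow 0)
  have := h.add_le l1 (h.add_le h3 (h.add_le l2 (l3.trans (mul_le_pow_add h4 le_rfl))))
  exact this.trans (h.pow_mono (by lia))

end Combinators

end RAM

namespace RAM

/-! ### Terms usable at every depth: sums, powers, remainders, minima -/

section Terms

variable {U W : ℕ}

/-- `Computes`, at every depth from `d` on. -/
def Term (U W a e d : ℕ) (p : Code) (s : State) (v : ℤ) : Prop :=
  ∀ d' s', d ≤ d' → Agree d s s' → Computes U W a e d' p s' v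

/-- The code `F x` computes `f j` whenever the register `x` contains `j < N`. -/
def Fn (U W a e d N : ℕ) (F : ℕ → Code) (s : State) (f : ℕ → ℤ) : Prop :=
  ∀ j < N, ∀ d' s' x, d ≤ d' → Agree d s s' → x < d' → s'.reg x = j →
    Term U W a e d' (F x) s' (f j)

namespace Term

variable {a b e f d : ℕ} {p q : Code} {s : State} {v w : ℤ}

theorem abs_le (hp : Term U W a e d p s v) : |v| ≤ U ^ a :=
  (hp d s le_rfl (.refl _ _)).abs_le

theorem agree (hp : Term U W a e d p s v) {d' : ℕ} {s' : State} (hd : d ≤ d')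
    (hs : Agree d s s') : Term U W a e d' p s' v :=
  fun _ _ hd' hs' => hp _ _ (hd.trans hd') (hs.trans hs' hd)

/-- Composition inflates the exponent of a value; a direct estimate of the value brings it down
again. -/
theorem retype (h : Units U W) (hp : Term U W a e d p s v) {a' e' : ℕ} (ha : |v| ≤ U ^ a')
    (he : e ≤ e') : Term U W a' e' d p s v :=
  fun d' s' hd hs => (hp d' s' hd hs).mono h ha he

theorem mono (h : Units U W) (hp : Term U W a e d p s v) {a' e' : ℕ} (ha : a ≤ a')
    (he : e ≤ e') : Term U W a' e' d p s v :=
  hp.retype h (hp.abs_le.trans (h.value_mono ha)) he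

theorem lit (h : Units U W) {c : ℤ} (hc : |c| ≤ U ^ a) : Term U W a (a + 2) d (.lit c) s c :=
  fun d' s' _ _ => .lit h hc d' s'

theorem var (h : Units U W) {r : ℕ} (hr : r < d) (hv : s.reg r = v) (ha : |v| ≤ U ^ a) :
    Term U W a (a + 3) d (.var r) s v :=
  fun _ _ hd hs => .var h (by lia) ((hs.2 r hr).trans hv) ha

theorem get (h : Units U W) {k : ℕ} (hp : Term U W a e d p s v) (hw : s.arr k v = w)
    (hb : |w| ≤ U ^ b) : Term U W b (a + b + e + 6) d (.get k p) s w :=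
  fun _ _ hd hs => .get h (hp _ _ hd hs) (by rw [hs.1, hw]) hb

theorem bin (h : Units U W) {o : Op} {c : ℕ} (hp : Term U W a e d p s v)
    (hq : Term U W b f d q s w) (hc : |o.apply v w| ≤ U ^ c) :
    Term U W c (a + b + e + f + 8) d (.bin o p q) s (o.apply v w) :=
  fun _ _ hd hs => .bin h (hp _ _ hd hs)
    (fun _ hs' => hq _ _ (by lia) (hs.trans hs' hd)) hc

theorem add (h : Units U W) (hp : Term U W a e d p s v) (hq : Term U W b f d q s w) :
    Term U W (a + b + 1) (a + b + e + f + 8) d (.bin .add p q) s (v + w) :=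
  hp.bin h hq (h.abs_add_le hp.abs_le hq.abs_le)

theorem sub (h : Units U W) (hp : Term U W a e d p s v) (hq : Term U W b f d q s w) :
    Term U W (a + b + 1) (a + b + e + f + 8) d (.bin .sub p q) s (v - w) :=
  hp.bin h hq (by
    rw [Op.apply, sub_eq_add_neg]
    exact h.abs_add_le hp.abs_le (by rw [abs_neg]; exact hq.abs_le))

theorem mul (h : Units U W) (hp : Term U W a e d p s v) (hq : Term U W b f d q s w) :
    Term U W (a + b) (a + b + e + f + 8) d (.bin .mul p q) s (v * w) :=
  hp.bin h hq (by
    rw [Op.apply, abs_mul, pow_add]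
    exact mul_le_mul hp.abs_le hq.abs_le (abs_nonneg _) (by positivity))

theorem div (h : Units U W) (hp : Term U W a e d p s v) (hq : Term U W b f d q s w) :
    Term U W a (a + b + e + f + 8) d (.bin .div p q) s (v / w) :=
  hp.bin h hq (by
    refine le_trans ?_ hp.abs_le
    have := Int.natAbs_ediv_le_natAbs v w
    rw [Op.apply, Int.abs_eq_natAbs, Int.abs_eq_natAbs]
    exact_mod_cast this)

theorem ite (h : Units U W) {c : Code} {g t : ℕ} {z : ℤ} (hc : Term U W g t d c s z)
    (hp : 0 < z → Term U W a e d p s v) (hq : ¬ 0 < z → Term U W b f d q s w) :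
    Term U W (a + b) (g + t + e + f + 6) d (.cond c p q) s (if 0 < z then v else w) := by
  intro d' s' hd hs
  refine .cond h (hc _ _ hd hs) (fun hz s'' hs'' => ?_) fun hz s'' hs'' => ?_
  · rw [if_pos hz]
    exact ((hp hz).mono h (Nat.le_add_right a b) le_rfl) _ _ hd (hs.trans hs'' hd)
  · rw [if_neg hz]
    exact ((hq hz).mono h (Nat.le_add_left b a) le_rfl) _ _ hd (hs.trans hs'' hd)

end Term

namespace Fn

variable {a e d N : ℕ} {F : ℕ → Code} {s : State} {f : ℕ → ℤ}

theorem agree (hF : Fn U W a e d N F s f) {d' : ℕ} {s' : State} (hd : d ≤ d')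
    (hs : Agree d s s') : Fn U W a e d' N F s' f :=
  fun j hj _ _ x hd' hs' => hF j hj _ _ x (hd.trans hd') (hs.trans hs' hd)

theorem term (hF : Fn U W a e d N F s f) {x j : ℕ} (hx : x < d) (hj : j < N)
    (hr : s.reg x = j) : Term U W a e d (F x) s (f j) :=
  hF j hj d s x le_rfl (.refl _ _) hx hr

end Fn

namespace Code

/-- Remainder of a division. -/
def mod (p q : Code) : Code := .bin .sub p (.bin .mul (.bin .div p q) q)

/-- The sum of `F 0, F 1, …`, with as many terms as register `r` says. -/
def sum (r : ℕ) (F : ℕ → Code) : Code :=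
  .fold (.lit 0) (.var r) fun a i => .bin .add (.var a) (F i)

/-- The power of register `r` with exponent `p`. -/
def pow (r : ℕ) (p : Code) : Code :=
  .fold (.lit 1) p fun a _ => .bin .mul (.var a) (.var r)

/-- The place of the minimum of `F` among the indices at which `B` is not positive. -/
def argmin (r : ℕ) (B F : ℕ → Code) : Code :=
  .fold (.lit (-1)) (.var r) fun a i => .cond (B i) (.var a)
    (.cond (.bin .sub (.lit 0) (.var a)) (.var i)
      (.cond (.bin .sub (F a) (F i)) (.var i) (.var a)))

end Code

/-- The place of the minimum of `f` among the `j < N` with `g j ≤ 0`, or `-1`. -/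
def argmin (g f : ℕ → ℤ) : ℕ → ℤ
  | 0 => -1
  | k + 1 => if 0 < g k then argmin g f k else if 0 < 0 - argmin g f k then k else
      if 0 < f (argmin g f k).toNat - f k then k else argmin g f k

theorem argmin_spec (g f : ℕ → ℤ) (N : ℕ) :
    (argmin g f N = -1 ∧ ∀ j < N, 0 < g j) ∨
      ∃ i < N, argmin g f N = i ∧ ¬ 0 < g i ∧ ∀ j < N, ¬ 0 < g j → f i ≤ f j := by
  induction N with
  | zero => left; simp [argmin]
  | succ k ih =>
    rcases ih with ⟨h1, h2⟩ | ⟨i, hi, h1, h2, h3⟩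
    · by_cases hk : 0 < g k
      · left
        refine ⟨by simp [argmin, hk, h1], fun j hj => ?_⟩
        rcases Nat.lt_succ_iff_lt_or_eq.1 hj with h | rfl
        · exact h2 j h
        · exact hk
      · right
        refine ⟨k, by lia, by simp [argmin, hk, h1], hk, fun j hj hgj => ?_⟩
        rcases Nat.lt_succ_iff_lt_or_eq.1 hj with h | rfl
        · exact absurd (h2 j h) hgj
        · exact le_rfl
    · right
      by_cases hk : 0 < g k
      · refine ⟨i, by lia, by simp [argmin, hk, h1], h2, fun j hj hgj => ?_⟩
        rcases Nat.lt_succ_iff_lt_or_eq.1 hj with h | rfl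
        · exact h3 j h hgj
        · exact absurd hk hgj
      · by_cases hf : 0 < f i - f k
        · refine ⟨k, by lia, by
            rw [argmin, if_neg hk, h1, if_neg (by lia), Int.toNat_natCast, if_pos hf], hk, fun j hj hgj => ?_⟩
          rcases Nat.lt_succ_iff_lt_or_eq.1 hj with h | rfl
          · have := h3 j h hgj
            lia
          · exact le_rfl
        · refine ⟨i, by lia, by
            rw [argmin, if_neg hk, h1, if_neg (by lia), Int.toNat_natCast, if_neg hf], h2, fun j hj hgj => ?_⟩
          rcases Nat.lt_succ_iff_lt_or_eq.1 hj with h | rfl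
          · exact h3 j h hgj
          · lia

namespace Term

variable {a b e f d : ℕ} {p q : Code} {s : State} {v w : ℤ}

theorem mod (h : Units U W) (hp : Term U W a e d p s v) (hq : Term U W b f d q s w)
    {c : ℕ} (hc : |v % w| ≤ U ^ c) :
    Term U W c (4 * a + 3 * b + 2 * e + 2 * f + 24) d (.mod p q) s (v % w) := by
  have := hp.sub h ((hp.div h hq).mul h hq)
  have hvw : v - v / w * w = v % w := by rw [Int.emod_def, mul_comm]
  rw [hvw] at this
  exact this.retype h hc (by lia)

theorem fold (h : Units U W) {e₀ e₁ : ℕ} {init lim : Code} {body : ℕ → ℕ → Code} {N : ℕ}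
    {v : ℕ → ℤ} (hN : N ≤ W ^ f) (hinit : Term U W a e₀ d init s (v 0))
    (hlim : Term U W b e₁ d lim s N)
    (hbody : ∀ j < N, ∀ d' s', d ≤ d' → Agree d s s' → s'.reg d' = v j → s'.reg (d' + 1) = j →
      Term U W a e (d' + 3) (body d' (d' + 1)) s' (v (j + 1))) :
    Term U W a (a + b + e₀ + e₁ + e + f + 15) d (.fold init lim body) s (v N) := by
  intro d' s' hd hs
  refine .fold h hN (hinit _ _ hd hs) (fun s'' hs'' => hlim _ _ (by lia) (hs.trans hs'' hd)) ?_
  intro j hj s'' hs'' h1 h2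
  exact hbody j hj d' s'' hd (hs.trans hs'' hd) h1 h2 _ _ le_rfl (.refl _ _)

/-- At most `U` summands cost only one more factor `U`, and this bounds all partial sums uniformly,
as `fold` demands. -/
theorem sum (h : Units U W) {r N : ℕ} {F : ℕ → Code} {g : ℕ → ℤ} (hr : r < d)
    (hN : s.reg r = N) (hNU : N ≤ U) (hNW : N ≤ W) (hF : Fn U W a e d N F s g) :
    Term U W (a + 1) (6 * a + e + 60) d (.sum r F) s (∑ j ∈ Finset.range N, g j) := by
  have hbound : ∀ j, j ≤ N → |∑ i ∈ Finset.range j, g i| ≤ U ^ (a + 1) := by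
    intro j hj
    calc |∑ i ∈ Finset.range j, g i| ≤ ∑ i ∈ Finset.range j, |g i| :=
          Finset.abs_sum_le_sum_abs _ _
      _ ≤ ∑ i ∈ Finset.range j, (U : ℤ) ^ a := by
          refine Finset.sum_le_sum fun i hi => ?_
          have hi' := Finset.mem_range.1 hi
          exact (hF i (by lia) (d + 1) (s.setReg d i) d (by lia)
            ((Agree.refl d s).setReg le_rfl _) (by lia) (by simp)).abs_le
      _ = j * U ^ a := by simp
      _ ≤ U * U ^ a := by gcongr; lia
      _ = U ^ (a + 1) := by ring
  have hNU' : |(N : ℤ)| ≤ U ^ 1 := by rw [Nat.abs_cast, pow_one]; exact_mod_cast hNU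
  refine (fold h (f := 1) (v := fun j => ∑ i ∈ Finset.range j, g i) (by simpa using hNW)
    ((lit h (c := 0) (a := a + 1) (by simp)))
    (var h hr hN hNU') (e := 3 * a + e + 20) ?_).mono h le_rfl (by lia)
  intro j hj d' s' hd hs h1 h2
  have := (var h (show d' < d' + 3 by lia) h1 (hbound j (by lia))).add h
    (hF j hj (d' + 3) s' (d' + 1) (by lia) hs (by lia) h2)
  simp only [Finset.sum_range_succ]
  refine this.retype h ?_ (by lia)
  simpa only [Finset.sum_range_succ] using hbound (j + 1) (by lia)

theorem pow (h : Units U W) {r B n : ℕ} (hr : r < d) (hB : s.reg r = B) (hB1 : 1 ≤ B)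
    (hBU : B ≤ U) (hn : n ≤ W) (hp : Term U W a e d p s n) (hU : B ^ n ≤ U) :
    Term U W 1 (a + e + 60) d (.pow r p) s ((B : ℤ) ^ n) := by
  refine (fold h (f := 1) (v := fun j => (B : ℤ) ^ j) (by simpa using hn)
    (lit h (c := 1) (a := 1) ?_) hp (e := 20) ?_).mono h le_rfl (by lia)
  · have := h.two_le
    simp only [abs_one, pow_one]
    exact_mod_cast (by lia : 1 ≤ U)
  · intro j hj d' s' hd hs h1 h2
    have hb : ∀ i ≤ n, |(B : ℤ) ^ i| ≤ U ^ 1 := by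
      intro i hi
      rw [abs_of_nonneg (by positivity), pow_one]
      exact_mod_cast (Nat.pow_le_pow_right hB1 hi).trans hU
    have := (var h (show d' < d' + 3 by lia) h1 (hb j (by lia))).mul h
      (var h (show r < d' + 3 by lia) ((hs.2 r hr).trans hB) (a := 1)
        (by rw [Nat.abs_cast, pow_one]; exact_mod_cast hBU))
    simp only [pow_succ (B : ℤ) j]
    refine this.retype h ?_ (by lia)
    simpa only [pow_succ (B : ℤ) j] using hb (j + 1) (by lia)

theorem argmin (h : Units U W) {r N : ℕ} {B F : ℕ → Code} {g k : ℕ → ℤ} (hr : r < d)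
    (hN : s.reg r = N) (hNU : N ≤ U) (hNW : N ≤ W) (hB : Fn U W a e d N B s g)
    (hF : Fn U W b f d N F s k) :
    Term U W 1 (a + e + 6 * b + 2 * f + 150) d (.argmin r B F) s (RAM.argmin g k N) := by
  have hbound : ∀ j ≤ N, |RAM.argmin g k j| ≤ U ^ 1 := by
    intro j hj
    have := h.two_le
    rw [pow_one]
    rcases argmin_spec g k j with ⟨h1, -⟩ | ⟨i, hi, h1, -⟩
    · rw [h1]; simp; lia
    · rw [h1, Nat.abs_cast]
      exact_mod_cast (by lia : i ≤ U)
  have hcast : ∀ j ≤ N, |(j : ℤ)| ≤ U ^ 1 := by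
    intro j hj
    rw [Nat.abs_cast, pow_one]; exact_mod_cast hj.trans hNU
  refine (fold h (f := 1) (v := fun j => RAM.argmin g k j) (by simpa using hNW)
    (lit h (c := -1) (a := 1) (hbound 0 (by lia)))
    (var h hr hN (hcast N le_rfl)) (e := a + e + 4 * b + 2 * f + 90) ?_).mono h le_rfl (by lia)
  intro j hj d' s' hd hs h1 h2
  have hacc := var h (show d' < d' + 3 by lia) h1 (hbound j (by lia))
  have hi := var h (show d' + 1 < d' + 3 by lia) h2 (hcast j (by lia))
  have hFj := hF j hj (d' + 3) s' (d' + 1) (by lia) hs (by lia) h2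
  refine ((hB j hj (d' + 3) s' (d' + 1) (by lia) hs (by lia) h2).ite h (fun _ => hacc)
    fun _ => ((lit h (c := 0) (a := 0) (by simp)).sub h hacc).ite h (fun _ => hi) fun hneg =>
      Term.ite h (a := 1) (b := 1) (g := 2 * b + 1) (t := 2 * b + 2 * f + 8) ?_ (fun _ => hi) fun _ => hacc).retype h
        (hbound (j + 1) (by lia)) ?_
  -- `F` is evaluated at the accumulator, which is a valid index here: the value `-1` was excluded
  -- by the preceding test.
  · rcases argmin_spec g k j with ⟨h3, -⟩ | ⟨i, hi, h3, -⟩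
    · simp [h3] at hneg
    · have h4 : (RAM.argmin g k j).toNat = i := by simp [h3]
      rw [h4]
      exact ((hF i (by lia) (d' + 3) s' d' (by lia) hs (by lia) (h1.trans h3)).sub h
        hFj).mono h (by lia) (by lia)
  · lia

end Term

end Terms

end RAM

/-! ### Parameters and expressions of the enumeration -/

namespace IQP

open RAM

variable (I : IQP)

/-- The number of possible coefficients of a constraint. -/
def base : ℕ := 2 * I.alpha + 1

/-- The number of possible left-hand sides of a constraint. -/
def rows : ℕ := I.base ^ I.n

/-- The bound on the coefficients of candidates. -/
def bnd : ℕ := (I.n + I.alpha + 2) ^ boundExp I.n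

/-- The number of possible coefficients of candidates. -/
def dg : ℕ := 2 * I.bnd + 1

/-- The number of coefficients of a candidate together with a direction. -/
def len : ℕ := I.n * (I.rows + 2) + 1

/-- The number of all candidates together with a direction. -/
def total : ℕ := I.dg ^ I.len

/-- The units suffice for the instance. -/
structure Sizes (U W : ℕ) : Prop extends Units U W where
  n_le : I.n ≤ U ∧ I.n ≤ W
  m_le : I.m ≤ U ∧ I.m ≤ W
  alpha_le : I.alpha ≤ U
  base_le : I.base ≤ U
  rows_le : I.rows ≤ U ∧ I.rows ≤ W
  bnd_le : I.bnd ≤ U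
  dg_le : I.dg ≤ U
  len_le : I.len ≤ U ∧ I.len ≤ W
  total_le : I.total ≤ U ∧ I.total ≤ W
  root_le : 4 * I.n + 4 ≤ U
  rootPow_le : (4 * I.n + 4) ^ I.n ≤ U
  seed_le : I.n + I.alpha + 2 ≤ U
  exp_le : boundExp I.n ≤ U ∧ boundExp I.n ≤ W
  b_le : ∀ i, |I.b i| ≤ U

/-- The constraints and the constants of the instance are in their places in memory. -/
structure Env (d : ℕ) (s : State) : Prop where
  le : 20 ≤ d
  arr1 : s.arr 1 = matArr I.A
  arr2 : s.arr 2 = vecArr I.b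
  reg0 : s.reg 0 = I.n
  reg1 : s.reg 1 = I.m
  reg2 : s.reg 2 = I.alpha
  reg3 : s.reg 3 = I.base
  reg4 : s.reg 4 = I.rows
  reg5 : s.reg 5 = I.bnd
  reg6 : s.reg 6 = I.dg
  reg7 : s.reg 7 = I.len
  reg8 : s.reg 8 = I.total

variable {I}

theorem Env.agree {d d' : ℕ} {s s' : State} (hE : I.Env d s) (hd : d ≤ d')
    (hs : Agree d s s') : I.Env d' s' := by
  obtain ⟨h0, h1, h2, h3, h4, h5, h6, h7, h8, h9, h10, h11⟩ := hE
  refine ⟨by lia, ?_, ?_, ?_, ?_, ?_, ?_, ?_, ?_, ?_, ?_, ?_⟩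
  · rw [hs.1, h1]
  · rw [hs.1, h2]
  all_goals rw [hs.2 _ (by lia)]; assumption

theorem vecArr_natCast {k : ℕ} (v : Fin k → ℤ) (i : Fin k) : vecArr v ((i : ℕ) : ℤ) = v i := by
  simp [vecArr]

theorem abs_vecArr_le {k : ℕ} {v : Fin k → ℤ} {B : ℤ} (hB : 0 ≤ B) (hv : ∀ i, |v i| ≤ B) (z : ℤ) :
    |vecArr v z| ≤ B := by
  unfold vecArr
  split_ifs
  · exact hv _
  · simpa using hB

theorem matArr_natCast {m n : ℕ} (M : Matrix (Fin m) (Fin n) ℤ) (i : Fin m) (j : Fin n) :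
    matArr M ((i : ℕ) * n + (j : ℕ)) = M i j := by
  have hlt : (i : ℕ) * n + j < m * n := by
    have := i.2
    have := j.2
    calc (i : ℕ) * n + j < i * n + n := by lia
      _ = (i + 1) * n := by ring
      _ ≤ m * n := Nat.mul_le_mul_right _ (by lia)
  have h := vecArr_natCast (fun k : Fin (m * n) => M k.divNat k.modNat) ⟨i * n + j, hlt⟩
  have hn : 0 < n := Nat.pos_of_ne_zero fun h => by have := j.2; lia
  rw [matArr, show ((i : ℕ) : ℤ) * n + (j : ℕ) = (((i : ℕ) * n + j : ℕ) : ℤ) by push_cast; rfl]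
  refine h.trans ?_
  congr 1
  · ext
    simp [Fin.divNat, Nat.mul_add_div hn, mul_comm _ n]
  · ext
    simp [Fin.modNat, mul_comm _ n, Nat.mod_eq_of_lt j.2]

theorem abs_matArr_le {m n : ℕ} {M : Matrix (Fin m) (Fin n) ℤ} {B : ℤ} (hB : 0 ≤ B)
    (hM : ∀ i j, |M i j| ≤ B) (z : ℤ) : |matArr M z| ≤ B :=
  abs_vecArr_le hB (fun _ => hM _ _) z

theorem abs_Q_le (I : IQP) (i j : Fin I.n) : |I.Q i j| ≤ I.alpha := by
  rw [Int.abs_eq_natAbs]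
  have : (I.Q i j).natAbs ≤ I.alpha := le_max_of_le_left
    (Finset.le_sup (f := fun p : Fin I.n × Fin I.n => (I.Q p.1 p.2).natAbs)
      (Finset.mem_univ (i, j)))
  exact_mod_cast this

theorem abs_A_le (I : IQP) (i : Fin I.m) (j : Fin I.n) : |I.A i j| ≤ I.alpha := by
  rw [Int.abs_eq_natAbs]
  have : (I.A i j).natAbs ≤ I.alpha := le_max_of_le_right
    (Finset.le_sup (f := fun p : Fin I.m × Fin I.n => (I.A p.1 p.2).natAbs)
      (Finset.mem_univ (i, j)))
  exact_mod_cast this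

theorem abs_natCast_le {x U : ℕ} (hx : x ≤ U) : |(x : ℤ)| ≤ (U : ℤ) ^ 1 := by
  rw [pow_one, Nat.abs_cast]; exact_mod_cast hx

/-! ### Code for the parts of the algorithm -/

section Codes

/-- The entry of a matrix with `n` columns in array `k`. -/
def entC (k ri rj : ℕ) : Code := .get k (.bin .add (.bin .mul (.var ri) (.var 0)) (.var rj))

/-- `1` if the values differ, `0` otherwise. -/
def neC (p q : Code) : Code :=
  .cond (.bin .sub p q) (.lit 1) (.cond (.bin .sub q p) (.lit 1) (.lit 0))

/-- The number of coefficients of constraint `ri` that differ from the digits of `rk`. -/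
def mismatchC (rk ri : ℕ) : Code :=
  .sum 0 fun j => neC (.mod (.bin .div (.var rk) (.pow 3 (.var j))) (.var 3))
    (.bin .add (entC 1 ri j) (.var 2))

/-- The smallest right-hand side of the constraints whose left-hand side is encoded by `rk`. -/
def betaC (rk : ℕ) : Code :=
  .get 2 (.argmin 1 (fun i => mismatchC rk i) fun i => .get 2 (.var i))

/-- A coefficient of the candidate number `rc`. -/
def digC (rc : ℕ) (p : Code) : Code :=
  .bin .sub (.mod (.bin .div (.var rc) (.pow 6 p)) (.var 6)) (.var 5)

/-- The position of the coefficient `p` of coordinate `rj`. -/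
def posC (rj : ℕ) (p : Code) : Code :=
  .bin .add (.lit 1) (.bin .add (.bin .mul (.var rj) (.bin .add (.var 4) (.lit 2))) p)

/-- Coordinate `rj` of the candidate number `rc`. -/
def xC (rc rj : ℕ) : Code :=
  .bin .div (.bin .add
      (.sum 4 fun k => .bin .mul (digC rc (posC rj (.var k))) (betaC k))
      (digC rc (posC rj (.var 4))))
    (.bin .add (.bin .add (digC rc (.lit 0)) (.var 5)) (.lit 1))

/-- Coordinate `rj` of the direction that accompanies the candidate number `rc`. -/
def yC (rc rj : ℕ) : Code := digC rc (posC rj (.bin .add (.var 4) (.lit 1)))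

/-- The left-hand side of constraint `ri` at the vector `F`. -/
def linC (ri : ℕ) (F : ℕ → Code) : Code := .sum 0 fun j => .bin .mul (entC 1 ri j) (F j)

/-- The number of constraints that are violated by the vector `F`. -/
def violC (F : ℕ → Code) : Code :=
  .sum 1 fun i => .cond (.bin .sub (linC i F) (.get 2 (.var i))) (.lit 1) (.lit 0)

/-- The number of homogenized constraints that are violated by the vector `F`. -/
def recC (F : ℕ → Code) : Code := .sum 1 fun i => .cond (linC i F) (.lit 1) (.lit 0)

/-- The objective function at the vector `F`. -/
def quadC (F : ℕ → Code) : Code :=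
  .sum 0 fun i => .bin .mul (F i) (.sum 0 fun j => .bin .mul (entC 0 i j) (F j))

/-- The number of the best feasible candidate, or `-1`. -/
def bestC : Code := .argmin 8 (fun c => violC (xC c)) fun c => quadC (xC c)

/-- `1` if the candidate number `c` and its direction prove unboundedness, `0` otherwise. -/
def certC (c : ℕ) : Code :=
  .cond (violC (xC c)) (.lit 0) (.cond (recC (yC c)) (.lit 0)
    (.cond (.bin .sub (.lit 0) (quadC (yC c))) (.lit 1) (.cond (quadC (yC c)) (.lit 0)
      (.cond (.bin .sub (quadC (xC c)) (quadC fun j => .bin .add (xC c j) (yC c j)))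
        (.lit 1) (.lit 0)))))

/-- The number of proofs of unboundedness. -/
def unbC : Code := .sum 8 certC

end Codes

/-! ### The values that they compute -/

section Values

variable (I)

/-- Value of `mismatchC`. -/
def mismatch (k i : ℕ) : ℤ := ∑ j ∈ Finset.range I.n,
  if 0 < (k : ℤ) / (I.base : ℤ) ^ j % I.base - (matArr I.A (i * I.n + j) + I.alpha) then 1 else
    if 0 < matArr I.A (i * I.n + j) + I.alpha - (k : ℤ) / (I.base : ℤ) ^ j % I.base then 1 else 0

/-- Value of `betaC`. -/
def beta (k : ℕ) : ℤ :=
  vecArr I.b (argmin (I.mismatch k) (fun i => vecArr I.b i) I.m)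

/-- Value of `digC`. -/
def dig (c p : ℕ) : ℤ := (c : ℤ) / (I.dg : ℤ) ^ p % I.dg - I.bnd

/-- Value of `posC`. -/
def pos (j k : ℕ) : ℕ := 1 + (j * (I.rows + 2) + k)

/-- Value of `xC`. -/
def xVal (c j : ℕ) : ℤ :=
  (∑ k ∈ Finset.range I.rows, I.dig c (I.pos j k) * I.beta k + I.dig c (I.pos j I.rows)) /
    (I.dig c 0 + I.bnd + 1)

/-- Value of `yC`. -/
def yVal (c j : ℕ) : ℤ := I.dig c (I.pos j (I.rows + 1))

/-- Value of `linC`. -/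
def lin (f : ℕ → ℤ) (i : ℕ) : ℤ := ∑ j ∈ Finset.range I.n, matArr I.A (i * I.n + j) * f j

/-- Value of `violC`. -/
def viol (f : ℕ → ℤ) : ℤ :=
  ∑ i ∈ Finset.range I.m, if 0 < I.lin f i - vecArr I.b i then 1 else 0

/-- Value of `recC`. -/
def recv (f : ℕ → ℤ) : ℤ := ∑ i ∈ Finset.range I.m, if 0 < I.lin f i then 1 else 0

/-- Value of `quadC`. -/
def quadVal (f : ℕ → ℤ) : ℤ := ∑ i ∈ Finset.range I.n,
  f i * ∑ j ∈ Finset.range I.n, matArr I.Q (i * I.n + j) * f j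

/-- Value of `certC`. -/
def cert (c : ℕ) : ℤ :=
  if 0 < I.viol (I.xVal c) then 0 else if 0 < I.recv (I.yVal c) then 0 else
    if 0 < 0 - I.quadVal (I.yVal c) then 1 else if 0 < I.quadVal (I.yVal c) then 0 else
      if 0 < I.quadVal (I.xVal c) - I.quadVal (fun j => I.xVal c j + I.yVal c j) then 1 else 0

end Values

/-! ### Values and costs of the expressions of the algorithm -/

section Specs

variable {U W : ℕ} (h : I.Sizes U W)
include h

theorem Sizes.lit_le {z : ℤ} (hz : |z| ≤ 2) : |z| ≤ (U : ℤ) ^ 1 := by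
  rw [pow_one]
  exact hz.trans (by exact_mod_cast h.two_le)

theorem Sizes.var {d r x : ℕ} {s : State} (hr : r < d) (hx : s.reg r = x) (hxU : x ≤ U) :
    Term U W 1 4 d (.var r) s x :=
  Term.var h.toUnits hr hx (abs_natCast_le hxU)

theorem Sizes.lit {d : ℕ} {s : State} {z : ℤ} (hz : |z| ≤ 2) : Term U W 1 3 d (.lit z) s z :=
  Term.lit h.toUnits (h.lit_le hz)

theorem Sizes.abs_b_le (z : ℤ) : |vecArr I.b z| ≤ (U : ℤ) ^ 1 := by
  rw [pow_one]
  exact abs_vecArr_le (by positivity) h.b_le z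

theorem Sizes.abs_A_le (z : ℤ) : |matArr I.A z| ≤ (U : ℤ) ^ 1 :=
  (abs_matArr_le (by positivity) (IQP.abs_A_le I) z).trans
    (by rw [pow_one]; exact_mod_cast h.alpha_le)

theorem Sizes.abs_Q_le (z : ℤ) : |matArr I.Q z| ≤ (U : ℤ) ^ 1 :=
  (abs_matArr_le (by positivity) (IQP.abs_Q_le I) z).trans
    (by rw [pow_one]; exact_mod_cast h.alpha_le)

variable {d : ℕ} {s : State}

theorem entC_term {k m ri rj i j : ℕ} {M : Matrix (Fin m) (Fin I.n) ℤ} (h0 : s.reg 0 = I.n)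
    (hd : 0 < d) (hk : s.arr k = matArr M) (hM : ∀ z, |matArr M z| ≤ (U : ℤ) ^ 1) (hri : ri < d)
    (hi : s.reg ri = i) (hiU : i ≤ U) (hrj : rj < d) (hj : s.reg rj = j) (hjU : j ≤ U) :
    Term U W 1 60 d (entC k ri rj) s (matArr M (i * I.n + j)) :=
  (Term.get h.toUnits ((((h.var hri hi hiU).mul h.toUnits (h.var hd h0 h.n_le.1))).add h.toUnits
    (h.var hrj hj hjU)) (by rw [hk]) (hM _)).mono h.toUnits le_rfl (by norm_num)

theorem neC_term {a b e f : ℕ} {p q : Code} {v w : ℤ} (hp : Term U W a e d p s v)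
    (hq : Term U W b f d q s w) :
    Term U W 1 (4 * a + 4 * b + 2 * e + 2 * f + 60) d (neC p q) s
      (if 0 < v - w then 1 else if 0 < w - v then 1 else 0) := by
  refine ((hp.sub h.toUnits hq).ite h.toUnits (fun _ => h.lit (by simp)) fun _ =>
    (hq.sub h.toUnits hp).ite h.toUnits (fun _ => h.lit (by simp)) fun _ =>
      h.lit (by simp)).retype h.toUnits (h.lit_le ?_) (by lia)
  split_ifs <;> simp

theorem mismatchC_term (hE : I.Env d s) {rk ri k i : ℕ} (hrk : rk < d) (hk : s.reg rk = k)
    (hkN : k < I.rows) (hri : ri < d) (hi : s.reg ri = i) (hiU : i ≤ U) :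
    Term U W 2 1300 d (mismatchC rk ri) s (I.mismatch k i) := by
  have hu := h.toUnits
  have hb1 : 1 ≤ I.base := by unfold base; lia
  refine (Term.sum hu (a := 1) (e := 1200) (by have := hE.le; lia) hE.reg0 h.n_le.1 h.n_le.2
    ?_).mono hu le_rfl (by norm_num)
  intro j hj d' s' x hd hs hx hreg
  have hE' := hE.agree hd hs
  have := hE'.le
  have hjU : j ≤ U := by have := h.n_le.1; lia
  have hpow : Term U W 1 70 d' (.pow 3 (.var x)) s' ((I.base : ℤ) ^ j) := by
    refine (Term.pow hu (by lia) hE'.reg3 hb1 h.base_le (by have := h.n_le.2; lia)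
      (h.var hx hreg hjU) ?_).mono hu le_rfl (by norm_num)
    -- Only exponents below `n` occur, so no power exceeds `rows`.
    exact (Nat.pow_le_pow_right hb1 (by lia)).trans h.rows_le.1
  have hmod : Term U W 1 400 d' (.mod (.bin .div (.var rk) (.pow 3 (.var x))) (.var 3)) s'
      ((k : ℤ) / (I.base : ℤ) ^ j % I.base) := by
    refine (Term.mod hu ((h.var (by lia) ((hs.2 rk hrk).trans hk)
      (by have := h.rows_le.1; lia)).div hu hpow)
      (h.var (by lia) hE'.reg3 h.base_le) ?_).mono hu le_rfl (by norm_num)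
    have h0 : (0 : ℤ) < I.base := by exact_mod_cast hb1
    rw [abs_of_nonneg (Int.emod_nonneg _ h0.ne'), pow_one]
    exact (Int.emod_lt_of_pos _ h0).le.trans (by exact_mod_cast h.base_le)
  have hent := entC_term h (k := 1) hE'.reg0 (by lia) hE'.arr1 h.abs_A_le
    (by lia) ((hs.2 ri hri).trans hi) hiU hx hreg hjU
  exact (neC_term h hmod (hent.add hu (h.var (by lia) hE'.reg2 h.alpha_le))).mono hu le_rfl
    (by norm_num)

theorem getB_term (hE : I.Env d s) {p : Code} {e : ℕ} {z : ℤ} (hp : Term U W 1 e d p s z) :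
    Term U W 1 (e + 8) d (.get 2 p) s (vecArr I.b z) :=
  (hp.get h.toUnits (by rw [hE.arr2]) (h.abs_b_le z)).mono h.toUnits le_rfl (by lia)

theorem betaC_term (hE : I.Env d s) {rk k : ℕ} (hrk : rk < d) (hk : s.reg rk = k)
    (hkN : k < I.rows) : Term U W 1 2000 d (betaC rk) s (I.beta k) := by
  have hu := h.toUnits
  have := hE.le
  refine (getB_term h hE (Term.argmin hu (a := 2) (e := 1300) (b := 1) (f := 12) (by lia) hE.reg1
    h.m_le.1 h.m_le.2 ?_ ?_)).mono hu le_rfl (by norm_num)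
  · intro i hi d' s' x hd hs hx hreg
    exact mismatchC_term h (hE.agree hd hs) (by lia) ((hs.2 rk hrk).trans hk) hkN hx hreg
      (by have := h.m_le.1; lia)
  · intro i hi d' s' x hd hs hx hreg
    exact getB_term h (hE.agree hd hs) (h.var hx hreg (by have := h.m_le.1; lia))

omit h in
theorem abs_dig_le (I : IQP) (c p : ℕ) : |I.dig c p| ≤ I.bnd := by
  have h0 : (0 : ℤ) < I.dg := by unfold dg; positivity
  have h1 := Int.emod_nonneg ((c : ℤ) / (I.dg : ℤ) ^ p) h0.ne'
  have h2 := Int.emod_lt_of_pos ((c : ℤ) / (I.dg : ℤ) ^ p) h0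
  have h3 : (I.dg : ℤ) = 2 * I.bnd + 1 := by unfold dg; push_cast; rfl
  unfold dig
  rw [abs_le]
  constructor <;> lia

theorem digC_term (hE : I.Env d s) {rc c p e : ℕ} {q : Code} (hrc : rc < d) (hc : s.reg rc = c)
    (hcM : c < I.total) (hp : p < I.len) (hq : Term U W 1 e d q s p) :
    Term U W 1 (2 * e + 300) d (digC rc q) s (I.dig c p) := by
  have hu := h.toUnits
  have := hE.le
  have hb1 : 1 ≤ I.dg := by unfold dg; lia
  have hpow : Term U W 1 (e + 70) d (.pow 6 q) s ((I.dg : ℤ) ^ p) := by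
    refine (Term.pow hu (by lia) hE.reg6 hb1 h.dg_le (by have := h.len_le.2; lia)
      hq ?_).mono hu le_rfl (by lia)
    exact (Nat.pow_le_pow_right hb1 hp.le).trans h.total_le.1
  have hmod : Term U W 1 (2 * e + 250) d (.mod (.bin .div (.var rc) (.pow 6 q)) (.var 6)) s
      ((c : ℤ) / (I.dg : ℤ) ^ p % I.dg) := by
    refine (Term.mod hu ((h.var hrc hc (by have := h.total_le.1; lia)).div hu hpow)
      (h.var (by lia) hE.reg6 h.dg_le) ?_).mono hu le_rfl (by lia)
    have h0 : (0 : ℤ) < I.dg := by exact_mod_cast hb1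
    rw [abs_of_nonneg (Int.emod_nonneg _ h0.ne'), pow_one]
    exact (Int.emod_lt_of_pos _ h0).le.trans (by exact_mod_cast h.dg_le)
  refine (hmod.sub hu (h.var (by lia) hE.reg5 h.bnd_le)).retype hu ?_ (by lia)
  refine (abs_dig_le I c p).trans ?_
  rw [pow_one]
  exact_mod_cast h.bnd_le

omit h in
theorem pos_lt {j k : ℕ} (hj : j < I.n) (hk : k < I.rows + 2) : I.pos j k < I.len := by
  have : (j + 1) * (I.rows + 2) ≤ I.n * (I.rows + 2) := Nat.mul_le_mul_right _ hj
  unfold pos len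
  lia

theorem posC_term (hE : I.Env d s) {rj j k e : ℕ} {q : Code} (hrj : rj < d)
    (hj : s.reg rj = j) (hjn : j < I.n) (hk : k < I.rows + 2) {a : ℕ} (hq : Term U W a e d q s k) :
    Term U W 1 (2 * a + e + 100) d (posC rj q) s (I.pos j k) := by
  have hu := h.toUnits
  have := hE.le
  have := ((h.lit (z := 1) (by simp)).add hu (((h.var hrj hj (by have := h.n_le.1; lia)).mul hu
    ((h.var (by lia) hE.reg4 h.rows_le.1).add hu (h.lit (z := 2) (by simp)))).add hu hq))
  have hcast : ((I.pos j k : ℕ) : ℤ) = 1 + ((j : ℤ) * (I.rows + 2) + k) := by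
    unfold pos; push_cast; rfl
  have hle := abs_natCast_le ((pos_lt hjn hk).le.trans h.len_le.1)
  rw [hcast] at hle ⊢
  exact this.retype hu hle (by lia)

theorem xC_term (hE : I.Env d s) {rc rj c j : ℕ} (hrc : rc < d) (hc : s.reg rc = c)
    (hcM : c < I.total) (hrj : rj < d) (hj : s.reg rj = j) (hjn : j < I.n) :
    Term U W 5 5000 d (xC rc rj) s (I.xVal c j) := by
  have hu := h.toUnits
  have := hE.le
  refine (((Term.sum hu (a := 2) (e := 3000) (by lia) hE.reg4 h.rows_le.1 h.rows_le.2 ?_).add hu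
    (digC_term h hE hrc hc hcM (pos_lt hjn (by lia)) (posC_term h hE hrj hj hjn (by lia)
      (h.var (by lia) hE.reg4 h.rows_le.1)))).div hu
    (((digC_term h hE hrc hc hcM (by unfold len; lia) (h.lit (z := 0) (by simp))).add hu
      (h.var (by lia) hE.reg5 h.bnd_le)).add hu (h.lit (by simp)))).mono hu
      (by norm_num) (by norm_num)
  intro k hk d' s' x hd hs hx hreg
  have hE' := hE.agree hd hs
  exact ((digC_term h hE' (by lia) ((hs.2 rc hrc).trans hc) hcM (pos_lt hjn (by lia))
    (posC_term h hE' (by lia) ((hs.2 rj hrj).trans hj) hjn (by lia)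
      (h.var hx hreg (by have := h.rows_le.1; lia)))).mul hu
    (betaC_term h hE' hx hreg hk)).mono hu (by norm_num) (by norm_num)

theorem yC_term (hE : I.Env d s) {rc rj c j : ℕ} (hrc : rc < d) (hc : s.reg rc = c)
    (hcM : c < I.total) (hrj : rj < d) (hj : s.reg rj = j) (hjn : j < I.n) :
    Term U W 1 1000 d (yC rc rj) s (I.yVal c j) := by
  have hu := h.toUnits
  have := hE.le
  have hk : Term U W 3 30 d (.bin .add (.var 4) (.lit 1)) s ((I.rows + 1 : ℕ) : ℤ) :=
    ((h.var (by lia) hE.reg4 h.rows_le.1).add hu (h.lit (by simp))).mono hu le_rfl (by norm_num)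
  exact (digC_term h hE hrc hc hcM (pos_lt hjn (by lia)) (posC_term h hE hrj hj hjn (by lia)
    hk)).mono hu le_rfl (by norm_num)

theorem xC_fn (hE : I.Env d s) {rc c : ℕ} (hrc : rc < d) (hc : s.reg rc = c)
    (hcM : c < I.total) : Fn U W 5 5000 d I.n (xC rc) s (I.xVal c) :=
  fun _ hj _ _ _ hd hs hx hreg =>
    xC_term h (hE.agree hd hs) (by lia) ((hs.2 rc hrc).trans hc) hcM hx hreg hj

theorem yC_fn (hE : I.Env d s) {rc c : ℕ} (hrc : rc < d) (hc : s.reg rc = c)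
    (hcM : c < I.total) : Fn U W 1 1000 d I.n (yC rc) s (I.yVal c) :=
  fun _ hj _ _ _ hd hs hx hreg =>
    yC_term h (hE.agree hd hs) (by lia) ((hs.2 rc hrc).trans hc) hcM hx hreg hj

theorem linC_term (hE : I.Env d s) {F : ℕ → Code} {f : ℕ → ℤ} {a e : ℕ}
    (hF : Fn U W a e d I.n F s f) {ri i : ℕ} (hri : ri < d) (hi : s.reg ri = i) (hiU : i ≤ U) :
    Term U W (a + 2) (7 * a + e + 150) d (linC ri F) s (I.lin f i) := by
  have hu := h.toUnits
  have := hE.le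
  refine (Term.sum hu (a := a + 1) (e := a + e + 80) (by lia) hE.reg0 h.n_le.1 h.n_le.2 ?_).mono
    hu le_rfl (by lia)
  intro j hj d' s' x hd hs hx hreg
  have hE' := hE.agree hd hs
  exact ((entC_term h hE'.reg0 (by lia) hE'.arr1 h.abs_A_le (by lia) ((hs.2 ri hri).trans hi) hiU
    hx hreg (by have := h.n_le.1; lia)).mul hu ((hF.agree hd hs).term hx hj hreg)).mono hu
    (by lia) (by lia)

theorem violC_term (hE : I.Env d s) {F : ℕ → Code} {f : ℕ → ℤ} {a e : ℕ}
    (hF : Fn U W a e d I.n F s f) :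
    Term U W 2 (9 * a + e + 400) d (violC F) s (I.viol f) := by
  have hu := h.toUnits
  have := hE.le
  refine (Term.sum hu (a := 1) (e := 9 * a + e + 300) (by lia) hE.reg1 h.m_le.1 h.m_le.2
    ?_).mono hu le_rfl (by lia)
  intro i hi d' s' x hd hs hx hreg
  have hE' := hE.agree hd hs
  have hiU : i ≤ U := by have := h.m_le.1; lia
  refine (Term.ite hu ((linC_term h hE' (hF.agree hd hs) hx hreg hiU).sub hu
    (getB_term h hE' (h.var hx hreg hiU))) (fun _ => h.lit (by simp))
    fun _ => h.lit (by simp)).retype hu (h.lit_le ?_) (by lia)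
  split_ifs <;> simp

theorem recC_term (hE : I.Env d s) {F : ℕ → Code} {f : ℕ → ℤ} {a e : ℕ}
    (hF : Fn U W a e d I.n F s f) :
    Term U W 2 (9 * a + e + 400) d (recC F) s (I.recv f) := by
  have hu := h.toUnits
  have := hE.le
  refine (Term.sum hu (a := 1) (e := 9 * a + e + 300) (by lia) hE.reg1 h.m_le.1 h.m_le.2
    ?_).mono hu le_rfl (by lia)
  intro i hi d' s' x hd hs hx hreg
  have hE' := hE.agree hd hs
  have hiU : i ≤ U := by have := h.m_le.1; lia
  refine (Term.ite hu (linC_term h hE' (hF.agree hd hs) hx hreg hiU) (fun _ => h.lit (by simp))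
    fun _ => h.lit (by simp)).retype hu (h.lit_le ?_) (by lia)
  split_ifs <;> simp

theorem quadC_term (hE : I.Env d s) (hQ : s.arr 0 = matArr I.Q) {F : ℕ → Code} {f : ℕ → ℤ}
    {a e : ℕ} (hF : Fn U W a e d I.n F s f) :
    Term U W (2 * a + 3) (30 * a + 2 * e + 400) d (quadC F) s (I.quadVal f) := by
  have hu := h.toUnits
  have := hE.le
  refine (Term.sum hu (a := 2 * a + 2) (e := 12 * a + 2 * e + 300) (by lia) hE.reg0 h.n_le.1
    h.n_le.2 ?_).mono hu le_rfl (by lia)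
  intro i hi d' s' x hd hs hx hreg
  have hE' := hE.agree hd hs
  have hF' := hF.agree hd hs
  refine ((hF'.term hx hi hreg).mul hu (Term.sum hu (a := a + 1) (e := a + e + 80) (by lia)
    hE'.reg0 h.n_le.1 h.n_le.2 ?_)).mono hu (by lia) (by lia)
  intro j hj d'' s'' y hd' hs' hy hreg'
  have hE'' := hE'.agree hd' hs'
  exact ((entC_term h hE''.reg0 (by lia) (by rw [hs'.1, hs.1, hQ]) h.abs_Q_le (by lia)
    ((hs'.2 x hx).trans hreg) (by have := h.n_le.1; lia)
    hy hreg' (by have := h.n_le.1; lia)).mul hu ((hF'.agree hd' hs').term hy hj hreg')).mono hu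
    (by lia) (by lia)

theorem bestC_term (hE : I.Env d s) (hQ : s.arr 0 = matArr I.Q) :
    Term U W 1 50000 d bestC s
      (argmin (fun c => I.viol (I.xVal c)) (fun c => I.quadVal (I.xVal c)) I.total) := by
  have hu := h.toUnits
  have := hE.le
  refine (Term.argmin hu (a := 2) (e := 6000) (b := 13) (f := 12000) (by lia) hE.reg8
    h.total_le.1 h.total_le.2 ?_ ?_).mono hu le_rfl (by norm_num)
  · intro c hc d' s' x hd hs hx hreg
    have hE' := hE.agree hd hs
    exact (violC_term h hE' (xC_fn h hE' hx hreg hc)).mono hu (by norm_num) (by norm_num)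
  · intro c hc d' s' x hd hs hx hreg
    have hE' := hE.agree hd hs
    exact (quadC_term h hE' (by rw [hs.1, hQ]) (xC_fn h hE' hx hreg hc)).mono hu
      (by norm_num) (by norm_num)

theorem unbC_term (hE : I.Env d s) (hQ : s.arr 0 = matArr I.Q) :
    Term U W 2 90000 d unbC s (∑ c ∈ Finset.range I.total, I.cert c) := by
  have hu := h.toUnits
  have := hE.le
  refine (Term.sum hu (a := 1) (e := 80000) (by lia) hE.reg8 h.total_le.1 h.total_le.2
    ?_).mono hu le_rfl (by norm_num)
  intro c hc d' s' r hd hs hr hreg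
  have hE' := hE.agree hd hs
  have hQ' : s'.arr 0 = matArr I.Q := by rw [hs.1, hQ]
  have hx := xC_fn h hE' hr hreg hc
  have hy := yC_fn h hE' hr hreg hc
  have hxy : Fn U W 7 6100 d' I.n (fun j => .bin .add (xC r j) (yC r j)) s'
      (fun j => I.xVal c j + I.yVal c j) :=
    fun j hj _ _ _ hd hs hx' hreg' => (((hx.agree hd hs).term hx' hj hreg').add hu
      ((hy.agree hd hs).term hx' hj hreg')).mono hu (by norm_num) (by norm_num)
  have hqy := quadC_term h hE' hQ' hy
  refine (Term.ite hu (violC_term h hE' hx) (fun _ => h.lit (by simp)) fun _ =>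
    Term.ite hu (recC_term h hE' hy) (fun _ => h.lit (by simp)) fun _ =>
    Term.ite hu ((h.lit (z := 0) (by simp)).sub hu hqy) (fun _ => h.lit (by simp)) fun _ =>
    Term.ite hu hqy (fun _ => h.lit (by simp)) fun _ =>
    Term.ite hu ((quadC_term h hE' hQ' hx).sub hu (quadC_term h hE' hQ' hxy))
      (fun _ => h.lit (by simp)) fun _ => h.lit (by simp)).retype hu (h.lit_le ?_) (by norm_num)
  split_ifs <;> simp

end Specs

end IQP

/-! ### Correctness of the enumeration -/

namespace IQP

open RAM Matrix

section Correctness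

variable {I : IQP}

theorem exists_digits {B L : ℕ} (E : ℕ → ℕ) (hE : ∀ p < L, E p < B) :
    ∃ c < B ^ L, ∀ p < L, c / B ^ p % B = E p := by
  let f : Fin L → Fin B := fun p => ⟨E p, hE p p.2⟩
  refine ⟨finFunctionFinEquiv f, (finFunctionFinEquiv f).2, fun p hp => ?_⟩
  have h := congrFun (finFunctionFinEquiv.symm_apply_apply f) ⟨p, hp⟩
  exact congrArg Fin.val h

theorem lin_eq (f : ℕ → ℤ) (i : Fin I.m) : I.lin f i = (I.A *ᵥ fun j => f j) i := by
  simp only [lin, Matrix.mulVec, dotProduct, Finset.sum_range, matArr_natCast]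

theorem quadVal_eq (f : ℕ → ℤ) : I.quadVal f = I.objective fun j => f j := by
  simp only [quadVal, objective, Matrix.mulVec, dotProduct, Finset.sum_range, matArr_natCast]

theorem sum_indicator_pos_iff {N : ℕ} {P : ℕ → Prop} [DecidablePred P] :
    0 < ∑ i ∈ Finset.range N, (if P i then (1 : ℤ) else 0) ↔ ∃ i < N, P i := by
  rw [Finset.sum_pos_iff_of_nonneg fun i _ => by split_ifs <;> simp]
  simp only [Finset.mem_range]
  refine exists_congr fun i => and_congr_right fun _ => ?_
  split_ifs with h <;> simp [h]

theorem not_viol_pos_iff (f : ℕ → ℤ) : ¬ 0 < I.viol f ↔ I.IsFeasible fun j => f j := by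
  rw [viol, sum_indicator_pos_iff]
  push Not
  constructor
  · intro h i
    have := h i i.2
    rw [lin_eq, vecArr_natCast] at this
    lia
  · intro h i hi
    have := h ⟨i, hi⟩
    have h1 := lin_eq (I := I) f ⟨i, hi⟩
    have h2 := vecArr_natCast I.b ⟨i, hi⟩
    simp only at h1 h2
    lia

theorem not_recv_pos_iff (f : ℕ → ℤ) : ¬ 0 < I.recv f ↔ I.A *ᵥ (fun j => f j) ≤ 0 := by
  rw [recv, sum_indicator_pos_iff]
  push Not
  constructor
  · intro h i
    have := h i i.2
    rwa [lin_eq] at this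
  · intro h i hi
    have := h ⟨i, hi⟩
    rwa [← lin_eq (I := I) f ⟨i, hi⟩] at this

theorem mismatch_pos_iff (k : ℕ) (i : Fin I.m) : 0 < I.mismatch k i ↔
    ∃ j : Fin I.n, (k : ℤ) / (I.base : ℤ) ^ (j : ℕ) % I.base ≠ I.A i j + I.alpha := by
  have : I.mismatch k i = ∑ j ∈ Finset.range I.n, if
      (k : ℤ) / (I.base : ℤ) ^ j % I.base ≠ matArr I.A ((i : ℕ) * I.n + j) + I.alpha
      then 1 else 0 := by
    refine Finset.sum_congr rfl fun j _ => ?_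
    split_ifs <;> lia
  rw [this, sum_indicator_pos_iff]
  constructor
  · rintro ⟨j, hj, h⟩
    refine ⟨⟨j, hj⟩, ?_⟩
    rwa [← matArr_natCast I.A i ⟨j, hj⟩]
  · rintro ⟨j, h⟩
    refine ⟨j, j.2, ?_⟩
    rwa [matArr_natCast]

/-- The code `k` of a left-hand side has the digits `A i j + α` in base `2α + 1`. A code that
belongs to no constraint yields index `-1`, hence `beta = 0`; such superfluous values do no harm. -/
theorem covers_beta (I : IQP) : Covers I.A I.b fun k : Fin I.rows => I.beta k := by
  intro i
  have hA : ∀ j, 0 ≤ I.A i j + I.alpha ∧ I.A i j + I.alpha < I.base := by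
    intro j
    have := abs_le.1 (abs_A_le I i j)
    have h2 : (I.base : ℤ) = 2 * I.alpha + 1 := by unfold base; push_cast; rfl
    lia
  obtain ⟨k, hk, hdig⟩ := exists_digits (B := I.base) (L := I.n)
    (fun j => if hj : j < I.n then (I.A i ⟨j, hj⟩ + I.alpha).toNat else 0) fun j hj => by
      have := hA ⟨j, hj⟩
      simp only [hj, dif_pos]
      lia
  have hdig' : ∀ j : Fin I.n,
      (k : ℤ) / (I.base : ℤ) ^ (j : ℕ) % I.base = I.A i j + I.alpha := by
    intro j
    have h1 := hdig j j.2
    simp only [j.2, dif_pos, Fin.eta] at h1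
    have h2 : ((k / I.base ^ (j : ℕ) % I.base : ℕ) : ℤ) = I.A i j + I.alpha := by
      rw [h1, Int.toNat_of_nonneg (hA j).1]
    rw [← h2]
    push_cast
    rfl
  have hi : ¬ 0 < I.mismatch k i := by
    rw [mismatch_pos_iff]
    push Not
    exact hdig'
  rcases argmin_spec (I.mismatch k) (fun i => vecArr I.b i) I.m with ⟨-, h⟩ | ⟨i', hi', h1, h2, h3⟩
  · exact absurd (h i i.2) hi
  · refine ⟨⟨i', hi'⟩, ?_, ?_, ⟨k, hk⟩, ?_⟩
    · have h4 := (mismatch_pos_iff (I := I) k ⟨i', hi'⟩).not.1 h2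
      push Not at h4
      ext j
      have h5 := h4 j
      have h6 := hdig' j
      lia
    · have h4 := h3 i i.2 hi
      rw [vecArr_natCast] at h4
      exact (vecArr_natCast I.b ⟨i', hi'⟩).symm.trans_le h4
    · change _ = I.beta k
      rw [beta, h1]
      exact (vecArr_natCast I.b ⟨i', hi'⟩).symm

theorem exists_dig_eq (E : ℕ → ℤ) (hE : ∀ p, |E p| ≤ I.bnd) :
    ∃ c < I.total, ∀ p < I.len, I.dig c p = E p := by
  have hE' := fun p => abs_le.1 (hE p)
  have h2 : (I.dg : ℤ) = 2 * I.bnd + 1 := by unfold dg; push_cast; rfl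
  obtain ⟨c, hc, hdig⟩ := exists_digits (B := I.dg) (L := I.len)
    (fun p => (E p + I.bnd).toNat) fun p _ => by have := hE' p; lia
  refine ⟨c, hc, fun p hp => ?_⟩
  have h3 : ((c / I.dg ^ p % I.dg : ℕ) : ℤ) = E p + I.bnd := by
    rw [hdig p hp, Int.toNat_of_nonneg (by have := hE' p; lia)]
  have h4 : I.dig c p = ((c / I.dg ^ p % I.dg : ℕ) : ℤ) - I.bnd := by
    unfold dig; push_cast; rfl
  rw [h4, h3]
  ring

/-- Digit `0` encodes the common denominator; then each coordinate has a block of `rows + 2` digits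
for the coefficients of the `β k`, the constant and the direction. For a genuine candidate the
division in `xVal` is exact. -/
theorem exists_number {x y : Fin I.n → ℤ}
    (hx : Candidate (fun k : Fin I.rows => I.beta k) I.bnd x) (hy : ∀ j, |y j| ≤ I.bnd) :
    ∃ c < I.total, ∀ j : Fin I.n, I.xVal c j = x j ∧ I.yVal c j = y j := by
  obtain ⟨D, hD1, hD2, ht⟩ := hx
  choose u w hu hw he using ht
  let N := I.rows + 2
  -- The denominator is recovered as digit plus `bnd + 1`, which is positive for every number `c`.
  let E : ℕ → ℤ := fun p => if p = 0 then D - 1 - I.bnd else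
    if hj : (p - 1) / N < I.n then
      if hk : (p - 1) % N < I.rows then u ⟨(p - 1) / N, hj⟩ ⟨(p - 1) % N, hk⟩ else
        if (p - 1) % N = I.rows then w ⟨(p - 1) / N, hj⟩ else y ⟨(p - 1) / N, hj⟩
    else 0
  have hE : ∀ p, |E p| ≤ I.bnd := by
    intro p
    simp only [E]
    split_ifs
    · rw [abs_le]; constructor <;> lia
    · exact hu _ _
    · exact hw _
    · exact hy _
    · simp
  obtain ⟨c, hc, hdig⟩ := exists_dig_eq E hE
  have hdiv : ∀ j k, k < N → (I.pos j k - 1) / N = j ∧ (I.pos j k - 1) % N = k := by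
    intro j k hk
    have : I.pos j k - 1 = k + N * j := by
      simp only [pos, N]; rw [Nat.add_sub_cancel_left]; ring
    rw [this]
    constructor
    · rw [Nat.add_mul_div_left _ _ (by lia), Nat.div_eq_of_lt hk, zero_add]
    · rw [Nat.add_mul_mod_self_left, Nat.mod_eq_of_lt hk]
  have hp0 : ∀ j k, I.pos j k ≠ 0 := by intro j k; unfold pos; lia
  refine ⟨c, hc, fun j => ⟨?_, ?_⟩⟩
  · have h0 : I.dig c 0 + I.bnd + 1 = D := by
      rw [hdig 0 (by unfold len; lia)]
      simp [E]
    have h1 : I.dig c (I.pos j I.rows) = w j := by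
      rw [hdig _ (pos_lt j.2 (by lia))]
      obtain ⟨e1, e2⟩ := hdiv j I.rows (by lia)
      simp [E, hp0, e1, e2]
    have h2 : ∀ k : Fin I.rows, I.dig c (I.pos j k) = u j k := by
      intro k
      rw [hdig _ (pos_lt j.2 (by lia))]
      obtain ⟨e1, e2⟩ := hdiv j k (by lia)
      simp [E, hp0, e1, e2]
    rw [xVal, h0, h1, Finset.sum_range]
    simp only [h2]
    rw [← he j, Int.mul_ediv_cancel_left _ (by lia)]
  · rw [yVal, hdig _ (pos_lt j.2 (by lia))]
    obtain ⟨e1, e2⟩ := hdiv j (I.rows + 1) (by lia)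
    simp [E, hp0, e1, e2]

theorem objective_add_smul (x y : Fin I.n → ℤ) (t : ℤ) : I.objective (x + t • y) =
    I.objective x + t * slope I.Q 0 x y + t ^ 2 * I.objective y := by
  have := quad_add_smul I.Q 0 x y t
  simpa [quad, objective] using this

theorem unbounded_of_direction {x y : Fin I.n → ℤ} (hx : I.IsFeasible x) (hy : I.A *ᵥ y ≤ 0)
    (h : I.objective y < 0 ∨ (I.objective y = 0 ∧ I.objective (x + y) < I.objective x)) :
    I.Unbounded := by
  intro β
  set a := I.objective x
  set r := slope I.Q 0 x y with hr
  -- Large enough in both cases: `t (t - r) ≥ |a| + |β| + 1` if the form is negative at `y`, and `a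
  -- - t ≤ -|β|` if it vanishes there.
  let t := |r| + |a| + |β| + 1
  have ht : 0 ≤ t := by positivity
  refine ⟨x + t • y, fun i => ?_, ?_⟩
  · have h1 := hx i
    have h2 := hy i
    simp only [mulVec_add, mulVec_smul, Pi.add_apply, Pi.smul_apply, smul_eq_mul,
      Pi.zero_apply] at h1 h2 ⊢
    nlinarith
  · rw [objective_add_smul]
    have h1 := le_abs_self r
    have h2 := le_abs_self a
    have h3 := neg_abs_le β
    have h4 := abs_nonneg r
    have h5 := abs_nonneg a
    have h6 := abs_nonneg β
    rcases h with h | ⟨h, h'⟩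
    · have h7 : t ^ 2 * I.objective y ≤ t ^ 2 * (-1) := by gcongr; lia
      have h8 : t * r + t ^ 2 * (-1) = - (t * (t - r)) := by ring
      have h9 : 1 * (|a| + |β| + 1) ≤ t * (t - r) := by
        gcongr <;> simp only [t] <;> lia
      lia
    · have h7 := objective_add_smul x y 1
      rw [one_smul, h] at h7
      have h8 : r ≤ -1 := by lia
      have h9 : t * r ≤ t * (-1) := by gcongr
      rw [h]
      simp only [t] at h9 ⊢
      lia

theorem cert_pos_iff (c : ℕ) : 0 < I.cert c ↔ I.IsFeasible (fun j => I.xVal c j) ∧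
    I.A *ᵥ (fun j => I.yVal c j) ≤ 0 ∧ (I.objective (fun j => I.yVal c j) < 0 ∨
      (I.objective (fun j => I.yVal c j) = 0 ∧
        I.objective ((fun j : Fin I.n => I.xVal c j) + fun j : Fin I.n => I.yVal c j) <
          I.objective fun j => I.xVal c j)) := by
  rw [← not_viol_pos_iff, ← not_recv_pos_iff, cert, quadVal_eq, quadVal_eq, quadVal_eq]
  change _ ↔ _ ∧ _ ∧ (_ ∨ (_ ∧ I.objective (fun j : Fin I.n => I.xVal c j + I.yVal c j) < _))
  split_ifs <;> grind

theorem sum_cert_pos_iff : 0 < ∑ c ∈ Finset.range I.total, I.cert c ↔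
    ∃ c < I.total, 0 < I.cert c := by
  rw [Finset.sum_pos_iff_of_nonneg fun c _ => by unfold cert; split_ifs <;> simp]
  simp

theorem unbounded_of_cert (h : 0 < ∑ c ∈ Finset.range I.total, I.cert c) :
    I.Feasible ∧ I.Unbounded := by
  obtain ⟨c, -, hc⟩ := sum_cert_pos_iff.1 h
  obtain ⟨h1, h2, h3⟩ := (cert_pos_iff c).1 hc
  exact ⟨⟨_, h1⟩, unbounded_of_direction h1 h2 h3⟩

/-- Without a certificate only the second alternative of `unbounded_or_candidates` is left, since a
pair from the first would be encoded by some number. -/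
theorem exists_candidate (h : ¬ 0 < ∑ c ∈ Finset.range I.total, I.cert c) {x : Fin I.n → ℤ}
    (hx : I.IsFeasible x) : ∃ c < I.total, I.IsFeasible (fun j => I.xVal c j) ∧
      I.objective (fun j => I.xVal c j) ≤ I.objective x := by
  have hZ : ((I.n + I.alpha + 2 : ℕ) : ℤ) ^ boundExp I.n = I.bnd := by
    unfold bnd; push_cast; rfl
  have hα : (I.alpha : ℤ) ≤ ((I.n + I.alpha + 2 : ℕ) : ℤ) := by push_cast; lia
  rcases unbounded_or_candidates (Z := ((I.n + I.alpha + 2 : ℕ) : ℤ)) (covers_beta I)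
    (by push_cast; lia) (by push_cast; lia) (fun i j => (abs_A_le I i j).trans hα)
    (fun i j => (abs_Q_le I i j).trans hα) hx with
    ⟨x', y, hxc, hx', hyb, hy, hd⟩ | ⟨x', hx', hxc, hle⟩
  · rw [hZ] at hxc hyb
    obtain ⟨c, hc, hcj⟩ := exists_number hxc hyb
    refine absurd (sum_cert_pos_iff.2 ⟨c, hc, (cert_pos_iff c).2 ?_⟩) h
    have e1 : (fun j : Fin I.n => I.xVal c j) = x' := funext fun j => (hcj j).1
    have e2 : (fun j : Fin I.n => I.yVal c j) = y := funext fun j => (hcj j).2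
    rw [e1, e2]
    -- The form vanishes at `y`, so the slope is the difference of the objective at `x' + y` and at
    -- `x'`, which is what `cert` tests.
    refine ⟨hx', hy, hd.imp_right fun ⟨h1, h2⟩ => ⟨h1, ?_⟩⟩
    have h3 := objective_add_smul x' y 1
    rw [one_smul] at h3
    have h4 : I.objective y = 0 := h1
    lia
  · rw [hZ] at hxc
    -- The direction is irrelevant here; zero fills its digits.
    obtain ⟨c, hc, hcj⟩ := exists_number hxc (y := 0) (by simp)
    have e1 : (fun j : Fin I.n => I.xVal c j) = x' := funext fun j => (hcj j).1
    exact ⟨c, hc, e1 ▸ hx', e1 ▸ hle⟩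

/-- The best of finitely many feasible candidates is optimal because every feasible point is matched
by one of them; in particular the minimum exists. -/
theorem infeasible_or_optimal (h : ¬ 0 < ∑ c ∈ Finset.range I.total, I.cert c) :
    (argmin (fun c => I.viol (I.xVal c)) (fun c => I.quadVal (I.xVal c)) I.total = -1 ∧
      ¬ I.Feasible) ∨
    ∃ c < I.total,
      argmin (fun c => I.viol (I.xVal c)) (fun c => I.quadVal (I.xVal c)) I.total = c ∧
      I.Feasible ∧ ¬ I.Unbounded ∧ I.IsOptimal fun j => I.xVal c j := by
  rcases argmin_spec (fun c => I.viol (I.xVal c)) (fun c => I.quadVal (I.xVal c)) I.total with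
    ⟨h1, h2⟩ | ⟨c, hc, h1, h2, h3⟩
  · refine .inl ⟨h1, fun ⟨x, hx⟩ => ?_⟩
    obtain ⟨c, hc, hf, -⟩ := exists_candidate h hx
    exact (not_viol_pos_iff _).2 hf (h2 c hc)
  · have hf := (not_viol_pos_iff _).1 h2
    have hopt : I.IsOptimal fun j => I.xVal c j := by
      refine ⟨hf, fun x hx => ?_⟩
      obtain ⟨c', hc', hf', hle⟩ := exists_candidate h hx
      have := h3 c' hc' ((not_viol_pos_iff _).2 hf')
      rw [quadVal_eq, quadVal_eq] at this
      exact this.trans hle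
    refine .inr ⟨c, hc, h1, ⟨_, hf⟩, fun hu => ?_, hopt⟩
    obtain ⟨x, hx, hle⟩ := hu (I.objective (fun j => I.xVal c j) - 1)
    have := hopt.2 x hx
    lia

end Correctness

end IQP

namespace IQP

open RAM Matrix

/-! ### The program -/

section Program

/-- Store the value of a term in register `r`. -/
def assign (r : ℕ) (p : Code) : Prog :=
  .seq (p 20) (.seq (.const 21 0) (.arith .add r 20 21))

/-- The absolute value. -/
def absC (p : Code) : Code := .cond p p (.bin .sub (.lit 0) p)

/-- The maximum of an initial value and the absolute values in an array. -/
def maxAbsC (k : ℕ) (init lim : Code) : Code :=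
  .fold init lim fun a i => .cond (.bin .sub (absC (.get k (.var i))) (.var a))
    (absC (.get k (.var i))) (.var a)

/-- The largest absolute value of a coefficient. -/
def alphaC : Code :=
  maxAbsC 1 (maxAbsC 0 (.lit 0) (.bin .mul (.var 0) (.var 0))) (.bin .mul (.var 1) (.var 0))

/-- `2 r + 1` -/
def oddC (r : ℕ) : Code := .bin .add (.bin .mul (.lit 2) (.var r)) (.lit 1)

/-- The exponent `boundExp n`, if register `12` contains `(4 n + 4) ^ n`. -/
def expC : Code :=
  .bin .mul (.bin .mul (.bin .add (.var 12) (.lit 5)) (.bin .add (.var 12) (.lit 5)))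
    (.bin .add (.bin .mul (.lit 2) (.var 0)) (.lit 2))

/-- The computation of all constants. -/
def setup : Prog :=
  .seq (assign 2 alphaC) <| .seq (assign 3 (oddC 2)) <| .seq (assign 4 (.pow 3 (.var 0))) <|
  .seq (assign 11 (.bin .add (.bin .mul (.lit 4) (.var 0)) (.lit 4))) <|
  .seq (assign 12 (.pow 11 (.var 0))) <|
  .seq (assign 13 (.bin .add (.bin .add (.var 0) (.var 2)) (.lit 2))) <|
  .seq (assign 5 (.pow 13 expC)) <| .seq (assign 6 (oddC 5)) <|
  .seq (assign 7 (.bin .add (.bin .mul (.var 0) (.bin .add (.var 4) (.lit 2))) (.lit 1))) <|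
  assign 8 (.pow 6 (.var 7))

/-- Write one coordinate of the candidate in register `9`. -/
def outputStep : Prog :=
  .seq (xC 9 14 20) <| .seq (.store 0 14 20) <| .seq (.const 16 1) <|
    .seq (.arith .add 14 14 16) (.arith .sub 15 15 16)

/-- Write the candidate in register `9`. -/
def output : Prog :=
  .seq (.const 14 0) <| .seq (.const 16 0) <| .seq (.arith .add 15 0 16) (.loop 15 outputStep)

/-- Write the answer. -/
def finish : Prog :=
  .ite 10 (.const 0 1) <| .seq (.const 16 1) <| .seq (.arith .add 17 9 16) <|
    .ite 17 (.seq output (.const 0 2)) (.const 0 0)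

/-- The algorithm. -/
def solver : Prog := .seq setup <| .seq (assign 9 bestC) <| .seq (assign 10 unbC) finish

end Program

/-! ### Running time and correctness of the program -/

section Running

variable {U W : ℕ}

/-- Started in a state that agrees with `s` below `20`, the program halts within time `W ^ e` in
a state that agrees with `s'` below `20`. -/
def Runs (W e : ℕ) (P : Prog) (s s' : State) : Prop :=
  ∀ s₀, Agree 20 s s₀ → ∃ s₁ t, Exec P s₀ s₁ t ∧ t ≤ W ^ e ∧ Agree 20 s' s₁

theorem Runs.seq (h : Units U W) {e f : ℕ} {P R : Prog} {s s' s'' : State}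
    (hP : Runs W e P s s') (hR : Runs W f R s' s'') :
    Runs W (e + f + 1) (.seq P R) s s'' := by
  intro s₀ hs₀
  obtain ⟨s₁, t, h1, h2, h3⟩ := hP s₀ hs₀
  obtain ⟨s₂, t', h1', h2', h3'⟩ := hR s₁ h3
  exact ⟨s₂, _, .seq h1 h1', h.add_le h2 h2', h3'⟩

theorem Runs.assign (h : Units U W) {a e : ℕ} {p : Code} {s : State} {v : ℤ}
    (hp : Term U W a e 20 p s v) (r : ℕ) :
    Runs W (a + e + 10) (assign r p) s (s.setReg r v) := by
  intro s₀ hs₀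
  obtain ⟨s₁, t, h1, h2, h3, h4⟩ := (hp 20 s₀ le_rfl hs₀).exec s₀ (.refl _ _)
  have hv : (s₁.setReg 21 0).reg 20 = v := by
    rw [State.reg_setReg_of_ne _ _ (by norm_num), h4]
  refine ⟨_, _, .seq h1 (.seq (.const _ _ _) (.arith _ _ _ _ _)), ?_, ?_⟩
  · rw [State.reg_setReg_self, hv]
    have h3 : bitLen 0 = 1 := rfl
    have h5 : 2 + 2 ≤ W ^ 1 := by rw [pow_one]; exact h.four_le
    have := h.add_le h2 (h.add_le h5 (h.bitLen_le hp.abs_le))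
    exact le_trans (by rw [h3]; lia) (this.trans (h.pow_mono (by lia)))
  · have hs1 := hs₀.trans h3 le_rfl
    rw [State.reg_setReg_self, hv]
    refine ⟨hs1.1, fun x hx => ?_⟩
    by_cases hxr : x = r
    · subst hxr
      simp [Op.apply]
    · rw [State.reg_setReg_of_ne _ _ hxr, State.reg_setReg_of_ne _ _ hxr,
        State.reg_setReg_of_ne _ _ (by lia), hs1.2 x hx]

/-- The maximum of `x` and of the absolute values `|f j|`, `j < N`. -/
def maxAbs (f : ℕ → ℤ) (x : ℤ) : ℕ → ℤ
  | 0 => x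
  | k + 1 => if 0 < |f k| - maxAbs f x k then |f k| else maxAbs f x k

theorem maxAbs_le_iff (f : ℕ → ℤ) (x z : ℤ) (N : ℕ) :
    maxAbs f x N ≤ z ↔ x ≤ z ∧ ∀ j < N, |f j| ≤ z := by
  induction N with
  | zero => simp [maxAbs]
  | succ k ih =>
    rw [Nat.forall_lt_succ_right, ← and_assoc, ← ih, maxAbs]
    split_ifs <;> grind

theorem le_maxAbs (f : ℕ → ℤ) (x : ℤ) (N : ℕ) : x ≤ maxAbs f x N :=
  ((maxAbs_le_iff f x _ N).1 le_rfl).1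

theorem absC_term (h : Units U W) {a e d : ℕ} {p : Code} {s : State} {v : ℤ}
    (hp : Term U W a e d p s v) :
    Term U W a (5 * a + 3 * e + 50) d (absC p) s |v| := by
  have : (if 0 < v then v else 0 - v) = |v| := by
    split_ifs with hv
    · exact (abs_of_pos hv).symm
    · rw [abs_of_nonpos (by lia), zero_sub]
  have h2 := (hp.ite h (fun _ => hp) fun _ => (Term.lit h (c := 0) (a := 0) (by simp)).sub h hp)
  rw [this] at h2
  exact h2.retype h (by rw [abs_abs]; exact hp.abs_le) (by lia)

theorem maxAbsC_term (h : Units U W) {k d N e e' : ℕ} {init lim : Code} {s : State} {x : ℤ}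
    (hk : ∀ z, |s.arr k z| ≤ (U : ℤ) ^ 1) (hx0 : 0 ≤ x) (hinit : Term U W 1 e d init s x)
    (hlim : Term U W 2 e' d lim s N) (hN : N ≤ W ^ 2) :
    Term U W 1 (e + e' + 500) d (maxAbsC k init lim) s (maxAbs (fun j => s.arr k j) x N) := by
  have hb : ∀ j, |maxAbs (fun j => s.arr k j) x j| ≤ (U : ℤ) ^ 1 := by
    intro j
    rw [abs_of_nonneg (hx0.trans (le_maxAbs _ _ _)), maxAbs_le_iff]
    exact ⟨(le_abs_self _).trans hinit.abs_le, fun j _ => hk j⟩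
  refine (Term.fold h (e := 300) (v := maxAbs (fun j => s.arr k j) x) hN hinit hlim ?_).mono h
    le_rfl (by lia)
  intro j hj d' s' hd hs h1 h2
  have hjU : |(j : ℤ)| ≤ (U : ℤ) ^ 2 := by
    refine le_trans ?_ hlim.abs_le
    rw [Nat.abs_cast, Nat.abs_cast]
    exact_mod_cast hj.le
  have hget : Term U W 1 14 (d' + 3) (.get k (.var (d' + 1))) s' (s.arr k j) :=
    (Term.get h (Term.var h (by lia) h2 hjU) (by rw [hs.1]) (hk j)).mono h le_rfl (by norm_num)
  have hacc := Term.var h (show d' < d' + 3 by lia) h1 (hb j)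
  exact (Term.ite h ((absC_term h hget).sub h hacc) (fun _ => absC_term h hget)
    fun _ => hacc).retype h (hb (j + 1)) (by norm_num)

variable {I : IQP}

theorem Env.setReg {d : ℕ} {s : State} (hE : I.Env d s) {x : ℕ} (hx : 8 < x) (v : ℤ) :
    I.Env d (s.setReg x v) := by
  obtain ⟨h0, h1, h2, h3, h4, h5, h6, h7, h8, h9, h10, h11⟩ := hE
  refine ⟨h0, h1, h2, ?_, ?_, ?_, ?_, ?_, ?_, ?_, ?_, ?_⟩
  all_goals rw [State.reg_setReg_of_ne _ _ (by lia)]; assumption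

theorem Env.setArr {d : ℕ} {s : State} (hE : I.Env d s) (i v : ℤ) :
    I.Env d (s.setArr 0 i v) := by
  obtain ⟨h0, h1, h2, h3, h4, h5, h6, h7, h8, h9, h10, h11⟩ := hE
  exact ⟨h0, by simpa [State.setArr] using h1, by simpa [State.setArr] using h2, h3, h4, h5, h6,
    h7, h8, h9, h10, h11⟩

/-- Each inequality is a statement about upper bounds: every cell of a matrix array is an entry or
zero, and entry `(i, j)` sits in cell `i * n + j`. -/
theorem maxAbs_eq_alpha (I : IQP) : maxAbs (fun j => matArr I.A j)
    (maxAbs (fun j => matArr I.Q j) 0 (I.n * I.n)) (I.m * I.n) = I.alpha := by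
  have hlt : ∀ {m n : ℕ} (i : Fin m) (j : Fin n), (i : ℕ) * n + j < m * n := by
    intro m n i j
    calc (i : ℕ) * n + j < i * n + n := by lia
      _ = (i + 1) * n := by ring
      _ ≤ m * n := Nat.mul_le_mul_right _ (by lia)
  refine le_antisymm ?_ ?_
  · rw [maxAbs_le_iff, maxAbs_le_iff]
    exact ⟨⟨by positivity, fun j _ => abs_matArr_le (by positivity) (abs_Q_le I) j⟩,
      fun j _ => abs_matArr_le (by positivity) (abs_A_le I) j⟩
  · generalize hM : maxAbs (fun j => matArr I.A j)
      (maxAbs (fun j => matArr I.Q j) 0 (I.n * I.n)) (I.m * I.n) = M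
    obtain ⟨h1, h2⟩ := (maxAbs_le_iff _ _ _ _).1 hM.le
    obtain ⟨h0, h1⟩ := (maxAbs_le_iff _ _ _ _).1 h1
    lift M to ℕ using h0
    norm_cast
    refine max_le (Finset.sup_le fun p _ => ?_) (Finset.sup_le fun p _ => ?_)
    · have h := h1 _ (hlt p.1 p.2)
      push_cast at h
      rw [matArr_natCast, Int.abs_eq_natAbs] at h
      exact_mod_cast h
    · have h := h2 _ (hlt p.1 p.2)
      push_cast at h
      rw [matArr_natCast, Int.abs_eq_natAbs] at h
      exact_mod_cast h

variable (h : I.Sizes U W)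
include h

theorem Sizes.lit' {d : ℕ} {s : State} {z : ℤ} (hz : |z| ≤ 8) : Term U W 3 5 d (.lit z) s z :=
  Term.lit h.toUnits (hz.trans (by
    have : (2 : ℤ) ^ 3 ≤ U ^ 3 := by gcongr; exact_mod_cast h.two_le
    exact this))

theorem oddC_term {s : State} {r x : ℕ} (hr : r < 20) (hx : s.reg r = x) (hxU : x ≤ U) :
    Term U W 6 50 20 (oddC r) s ((2 * x + 1 : ℕ) : ℤ) :=
  (((h.lit' (by simp)).mul h.toUnits (h.var hr hx hxU)).add h.toUnits (h.lit (by simp))).mono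
    h.toUnits (by norm_num) (by norm_num)

theorem alphaC_term : Term U W 1 2000 20 alphaC I.input I.alpha := by
  have hu := h.toUnits
  have h0 := h.var (d := 20) (s := I.input) (r := 0) (by norm_num) rfl h.n_le.1
  have h1 := h.var (d := 20) (s := I.input) (r := 1) (by norm_num) rfl h.m_le.1
  have hnn : Term U W 2 50 20 (.bin .mul (.var 0) (.var 0)) I.input ((I.n * I.n : ℕ) : ℤ) := by
    push_cast
    exact (h0.mul hu h0).mono hu le_rfl (by norm_num)
  have hmn : Term U W 2 50 20 (.bin .mul (.var 1) (.var 0)) I.input ((I.m * I.n : ℕ) : ℤ) := by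
    push_cast
    exact (h1.mul hu h0).mono hu le_rfl (by norm_num)
  have hq := maxAbsC_term hu (k := 0) h.abs_Q_le le_rfl (h.lit (z := 0) (by simp)) hnn
    (by rw [pow_two]; exact Nat.mul_le_mul h.n_le.2 h.n_le.2)
  have ha := maxAbsC_term hu (k := 1) h.abs_A_le (le_maxAbs _ _ _) hq hmn
    (by rw [pow_two]; exact Nat.mul_le_mul h.m_le.2 h.n_le.2)
  have := maxAbs_eq_alpha I
  refine (this ▸ ha : Term U W 1 _ 20 alphaC I.input I.alpha).mono hu le_rfl (by norm_num)

theorem expC_term {s : State} (h0 : s.reg 0 = I.n)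
    (h12 : s.reg 12 = ((4 * I.n + 4) ^ I.n : ℕ)) :
    Term U W 20 300 20 expC s (boundExp I.n : ℕ) := by
  have hu := h.toUnits
  have h12' := h.var (d := 20) (by norm_num) h12 h.rootPow_le
  have h0' := h.var (d := 20) (by norm_num) h0 h.n_le.1
  unfold boundExp
  push_cast at h12' ⊢
  exact (((h12'.add hu (h.lit' (by simp))).mul hu (h12'.add hu (h.lit' (by simp)))).mul hu
    (((h.lit' (by simp)).mul hu h0').add hu (h.lit' (by simp)))).mono hu (by norm_num)
    (by norm_num)

theorem setup_runs : ∃ s, Runs W 6000 setup I.input s ∧ I.Env 20 s ∧ s.arr 0 = matArr I.Q := by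
  have hu := h.toUnits
  have hb1 : 1 ≤ I.base := by unfold base; lia
  have hd1 : 1 ≤ I.dg := by unfold dg; lia
  -- All states are explicit register updates of the input, so the lookups needed later hold by
  -- `rfl`.
  let s₂ := I.input.setReg 2 I.alpha
  let s₃ := s₂.setReg 3 I.base
  let s₄ := s₃.setReg 4 I.rows
  let s₅ := s₄.setReg 11 (4 * I.n + 4 : ℕ)
  let s₆ := s₅.setReg 12 ((4 * I.n + 4) ^ I.n : ℕ)
  let s₇ := s₆.setReg 13 (I.n + I.alpha + 2 : ℕ)
  let s₈ := s₇.setReg 5 I.bnd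
  let s₉ := s₈.setReg 6 I.dg
  let s₁₀ := s₉.setReg 7 I.len
  let s₁₁ := s₁₀.setReg 8 I.total
  have r2 : Term U W 1 2000 20 alphaC I.input I.alpha := alphaC_term h
  have r3 : Term U W 6 50 20 (oddC 2) s₂ I.base := oddC_term h (by norm_num) rfl h.alpha_le
  have r4 : Term U W 1 80 20 (.pow 3 (.var 0)) s₃ I.rows := by
    have := (Term.pow hu (d := 20) (s := s₃) (r := 3) (by norm_num) rfl hb1 h.base_le h.n_le.2
      (h.var (r := 0) (by norm_num) rfl h.n_le.1) h.rows_le.1).mono hu le_rfl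
      (show _ ≤ 80 by norm_num)
    unfold rows; push_cast; exact this
  have r5 : Term U W 8 80 20 (.bin .add (.bin .mul (.lit 4) (.var 0)) (.lit 4)) s₄
      (4 * I.n + 4 : ℕ) := by
    push_cast
    exact (((h.lit' (by simp)).mul hu (h.var (r := 0) (by norm_num) rfl h.n_le.1)).add hu
      (h.lit' (by simp))).mono hu (by norm_num) (by norm_num)
  have r6 : Term U W 1 80 20 (.pow 11 (.var 0)) s₅ ((4 * I.n + 4) ^ I.n : ℕ) := by
    have := (Term.pow hu (d := 20) (s := s₅) (r := 11) (by norm_num) rfl (by lia) h.root_le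
      h.n_le.2 (h.var (r := 0) (by norm_num) rfl h.n_le.1) h.rootPow_le).mono hu le_rfl
      (show _ ≤ 80 by norm_num)
    push_cast at this ⊢; exact this
  have r7 : Term U W 5 80 20 (.bin .add (.bin .add (.var 0) (.var 2)) (.lit 2)) s₆
      (I.n + I.alpha + 2 : ℕ) := by
    push_cast
    exact (((h.var (r := 0) (by norm_num) rfl h.n_le.1).add hu
      (h.var (r := 2) (by norm_num) rfl h.alpha_le)).add hu (h.lit (by simp))).mono hu
      (by norm_num) (by norm_num)
  have r8 : Term U W 1 400 20 (.pow 13 expC) s₇ I.bnd := by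
    have := (Term.pow hu (d := 20) (s := s₇) (r := 13) (by norm_num) rfl (by lia) h.seed_le
      h.exp_le.2 (expC_term h rfl rfl) h.bnd_le).mono hu le_rfl (show _ ≤ 400 by norm_num)
    unfold bnd; push_cast at this ⊢; exact this
  have r9 : Term U W 6 50 20 (oddC 5) s₈ I.dg := oddC_term h (by norm_num) rfl h.bnd_le
  have r10 : Term U W 8 80 20 (.bin .add (.bin .mul (.var 0) (.bin .add (.var 4) (.lit 2)))
      (.lit 1)) s₉ I.len := by
    unfold len
    push_cast
    exact (((h.var (r := 0) (by norm_num) rfl h.n_le.1).mul hu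
      ((h.var (r := 4) (by norm_num) rfl h.rows_le.1).add hu (h.lit (by simp)))).add hu
      (h.lit (by simp))).mono hu (by norm_num) (by norm_num)
  have r11 : Term U W 1 80 20 (.pow 6 (.var 7)) s₁₀ I.total := by
    have := (Term.pow hu (d := 20) (s := s₁₀) (r := 6) (by norm_num) rfl hd1 h.dg_le h.len_le.2
      (h.var (r := 7) (by norm_num) rfl h.len_le.1) h.total_le.1).mono hu le_rfl
      (show _ ≤ 80 by norm_num)
    unfold total; push_cast; exact this
  refine ⟨s₁₁, ?_, ⟨le_rfl, rfl, rfl, rfl, rfl, rfl, rfl, rfl, rfl, rfl, rfl, rfl⟩, rfl⟩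
  have run := (Runs.assign hu r2 2).seq hu <| (Runs.assign hu r3 3).seq hu <|
    (Runs.assign hu r4 4).seq hu <| (Runs.assign hu r5 11).seq hu <|
    (Runs.assign hu r6 12).seq hu <| (Runs.assign hu r7 13).seq hu <|
    (Runs.assign hu r8 5).seq hu <| (Runs.assign hu r9 6).seq hu <|
    (Runs.assign hu r10 7).seq hu (Runs.assign hu r11 8)
  intro s₀ hs₀
  obtain ⟨s', t, h1, h2, h3⟩ := run s₀ hs₀
  exact ⟨s', t, h1, h2.trans (hu.pow_mono (by norm_num)), h3⟩

/-- Array `0` is overwritten while the coordinates are still being computed. This is harmless: `xC`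
reads only arrays `1` and `2`, and `Env` does not constrain array `0`. -/
theorem output_exec {s : State} {c : ℕ} (hE : I.Env 20 s) (hc : s.reg 9 = c)
    (hcM : c < I.total) : ∃ s' t, Exec output s s' t ∧ t ≤ W ^ 6000 ∧
      ∀ j : Fin I.n, s'.arr 0 (j : ℕ) = I.xVal c j := by
  have hu := h.toUnits
  have hb : ∀ j : ℕ, j ≤ I.n → bitLen j ≤ W ^ 2 := fun j hj =>
    hu.bitLen_le (abs_natCast_le (by have := h.n_le.1; lia))
  have b1 : bitLen 1 = 2 := rfl
  have b0 : bitLen 0 = 1 := rfl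
  -- Register `14` holds the next coordinate to be written, register `15` the number of remaining
  -- ones.
  have hloop : ∀ r j : ℕ, j + r = I.n → ∀ s₁, I.Env 20 s₁ → s₁.reg 9 = c → s₁.reg 14 = j →
      s₁.reg 15 = r → (∀ i < j, s₁.arr 0 (i : ℕ) = I.xVal c i) →
      ∃ s' t, Exec (.loop 15 outputStep) s₁ s' t ∧ t ≤ (r + 1) * W ^ 5900 ∧
        ∀ i < I.n, s'.arr 0 (i : ℕ) = I.xVal c i := by
    intro r
    induction r with
    | zero =>
      intro j hj s₁ hE₁ h9 h14 h15 harr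
      refine ⟨s₁, _, .loop_done (by simp [h15]), ?_, fun i hi => harr i (by lia)⟩
      have h4 : W ≤ W ^ 5900 := Nat.le_self_pow (by norm_num) _
      have h5 : bitLen ((0 : ℕ) : ℤ) = 1 := rfl
      have := hu.four_le
      rw [h15, h5, zero_add, one_mul]
      exact le_trans (by lia) h4
    | succ r ih =>
      intro j hj s₁ hE₁ h9 h14 h15 harr
      have hx := xC_term h hE₁ (rc := 9) (rj := 14) (by norm_num) h9 hcM (by norm_num) h14
        (show j < I.n by lia)
      obtain ⟨s₂, t, hex, ht, hag, hres⟩ := (hx 20 s₁ le_rfl (.refl _ _)).exec s₁ (.refl _ _)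
      have hE₂ := hE₁.agree le_rfl hag
      have e9 : s₂.reg 9 = c := (hag.2 _ (by norm_num)).trans h9
      have e14 : s₂.reg 14 = j := (hag.2 _ (by norm_num)).trans h14
      have e15 : s₂.reg 15 = (r + 1 : ℕ) := (hag.2 _ (by norm_num)).trans h15
      have earr : ∀ i < j, s₂.arr 0 (i : ℕ) = I.xVal c i := fun i hi => by
        rw [hag.1]; exact harr i hi
      let s₃ := s₂.setArr 0 (s₂.reg 14) (s₂.reg 20)
      let s₄ := s₃.setReg 16 1
      let s₅ := s₄.setReg 14 (Op.add.apply (s₄.reg 14) (s₄.reg 16))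
      let s₆ := s₅.setReg 15 (Op.sub.apply (s₅.reg 15) (s₅.reg 16))
      have f14 : s₄.reg 14 = j := e14
      have f16 : s₄.reg 16 = 1 := rfl
      have g15 : s₅.reg 15 = (r + 1 : ℕ) := e15
      have g16 : s₅.reg 16 = 1 := rfl
      have hE₆ : I.Env 20 s₆ := (((hE₂.setArr _ _).setReg (by norm_num) _).setReg
        (by norm_num) _).setReg (by norm_num) _
      have k14 : s₆.reg 14 = (j + 1 : ℕ) := by
        change Op.add.apply (s₄.reg 14) (s₄.reg 16) = _
        rw [f14, f16, Op.apply]; push_cast; rfl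
      have k15 : s₆.reg 15 = r := by
        change Op.sub.apply (s₅.reg 15) (s₅.reg 16) = _
        rw [g15, g16, Op.apply]; push_cast; ring
      have karr : ∀ i < j + 1, s₆.arr 0 (i : ℕ) = I.xVal c i := by
        intro i hi
        change (s₂.setArr 0 (s₂.reg 14) (s₂.reg 20)).arr 0 (i : ℕ) = _
        rw [e14, hres]
        simp only [State.setArr, Function.update_self]
        by_cases hij : i = j
        · subst hij; simp
        · rw [Function.update_of_ne (by exact_mod_cast hij)]
          exact earr i (by lia)
      obtain ⟨s', t', hex', ht', hfin⟩ := ih (j + 1) (by lia) s₆ hE₆ e9 k14 k15 karr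
      refine ⟨s', _, .loop_step (by rw [h15]; positivity) (.seq hex (.seq (.store s₂ _ _ _)
        (.seq (.const s₃ _ _) (.seq (.arith s₄ _ _ _ _) (.arith s₅ _ _ _ _))))) hex', ?_, hfin⟩
      rw [f14, f16, g15, g16, h15, e14, hres, b1]
      have l1 := hb (r + 1) (by lia)
      have l2 := hb j (by lia)
      have l3 : bitLen (I.xVal c j) ≤ W ^ 6 := hu.bitLen_le hx.abs_le
      have l4 : 12 + 2 * bitLen ((r + 1 : ℕ) : ℤ) + 2 * bitLen (j : ℤ) + bitLen (I.xVal c j) + t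
          ≤ W ^ 5900 := by
        have l5 : 12 ≤ W ^ 2 := by have := hu.four_le; nlinarith
        have l6 := hu.add_le (hu.add_le (hu.add_le (hu.add_le (hu.add_le (hu.add_le l5 l1) l1)
          l2) l2) l3) ht
        exact le_trans (by lia) (l6.trans (hu.pow_mono (by norm_num)))
      rw [add_mul (r + 1), one_mul]
      lia
  let s₁ := s.setReg 14 0
  let s₂ := s₁.setReg 16 0
  let s₃ := s₂.setReg 15 (Op.add.apply (s₂.reg 0) (s₂.reg 16))
  have q0 : s₂.reg 0 = I.n := hE.reg0
  have q16 : s₂.reg 16 = 0 := rfl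
  have q15 : s₃.reg 15 = I.n := by
    change Op.add.apply (s₂.reg 0) (s₂.reg 16) = _
    rw [q0, q16, Op.apply, add_zero]
  obtain ⟨s', t, hex, ht, hfin⟩ := hloop I.n 0 (by lia) s₃
    (((hE.setReg (by norm_num) _).setReg (by norm_num) _).setReg (by norm_num) _) hc rfl q15
    (by simp)
  refine ⟨s', _, .seq (.const s _ _) (.seq (.const s₁ _ _) (.seq (.arith s₂ _ _ _ _) hex)), ?_,
    fun j => hfin j j.2⟩
  rw [q0, q16, b0]
  have l1 := hb I.n le_rfl
  have l5 : 6 ≤ W ^ 2 := by have := hu.four_le; nlinarith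
  have l6 : I.n + 1 ≤ W ^ (1 + 0 + 1) :=
    hu.add_le (by rw [pow_one]; exact h.n_le.2) (hu.one_le_pow 0)
  have l7 := hu.add_le (hu.add_le l5 l1) (ht.trans (mul_le_pow_add l6 le_rfl))
  exact le_trans (by lia) (l7.trans (hu.pow_mono (by norm_num)))

theorem finish_exec {s : State} (hE : I.Env 20 s)
    (h9 : s.reg 9 = argmin (fun c => I.viol (I.xVal c)) (fun c => I.quadVal (I.xVal c)) I.total)
    (h10 : s.reg 10 = ∑ c ∈ Finset.range I.total, I.cert c) (hU : |s.reg 10| ≤ (U : ℤ) ^ 2) :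
    ∃ s' t, ∃ a : Answer I.n, Exec finish s s' t ∧ t ≤ W ^ 7000 ∧ a.WrittenIn s' ∧
      a.IsCorrect I := by
  have hu := h.toUnits
  have b1 : bitLen 1 = 2 := rfl
  have b0 : bitLen 0 = 1 := rfl
  have b2 : bitLen 2 = 3 := rfl
  have bneg : bitLen (-1) = 2 := rfl
  have l10 : bitLen (s.reg 10) ≤ W ^ 3 := hu.bitLen_le hU
  have l5 : 16 ≤ W ^ 2 := by have := hu.four_le; nlinarith
  by_cases hpos : 0 < s.reg 10
  · refine ⟨_, _, .unbounded, .ite_pos hpos (.const _ _ _), ?_, by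
      simp [Answer.WrittenIn], unbounded_of_cert (h10 ▸ hpos)⟩
    rw [b1]
    have := hu.add_le l5 l10
    exact le_trans (by lia) (this.trans (hu.pow_mono (by norm_num)))
  let s₁ := s.setReg 16 1
  let s₂ := s₁.setReg 17 (Op.add.apply (s₁.reg 9) (s₁.reg 16))
  have q9 : s₁.reg 9 = s.reg 9 := rfl
  have q16 : s₁.reg 16 = 1 := rfl
  -- Adding `1` turns the marker `-1` for "no feasible candidate" into `0` and every index into a
  -- positive number.
  have q17 : s₂.reg 17 = s.reg 9 + 1 := rfl
  rcases infeasible_or_optimal (h10 ▸ hpos) with ⟨hbest, hinf⟩ | ⟨c, hc, hbest, hopt⟩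
  · rw [hbest] at h9
    refine ⟨_, _, .infeasible, .ite_neg hpos (.seq (.const _ _ _) (.seq (.arith s₁ _ _ _ _)
      (.ite_neg (s := s₂) (by rw [q17, h9]; norm_num) (.const _ _ _)))), ?_, by
      simp [Answer.WrittenIn], hinf⟩
    rw [q9, q16, q17, h9, neg_add_cancel, b1, b0, bneg]
    have := hu.add_le l5 l10
    exact le_trans (by lia) (this.trans (hu.pow_mono (by norm_num)))
  · rw [hbest] at h9
    have hE₂ : I.Env 20 s₂ := (hE.setReg (by norm_num) _).setReg (by norm_num) _
    obtain ⟨s', t, hex, ht, hx⟩ := output_exec h hE₂ h9 hc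
    refine ⟨_, _, .optimum fun j => I.xVal c j, .ite_neg hpos (.seq (.const _ _ _)
      (.seq (.arith s₁ _ _ _ _) (.ite_pos (s := s₂) (by rw [q17, h9]; positivity)
        (.seq hex (.const _ _ _))))), ?_, ⟨by simp, hx⟩, hopt⟩
    rw [q9, q16, q17, h9, b1, b2]
    have l1 : bitLen (c : ℤ) ≤ W ^ 2 :=
      hu.bitLen_le (abs_natCast_le (by have := h.total_le.1; lia))
    have l2 : bitLen ((c : ℤ) + 1) ≤ W ^ 2 := by
      have := hu.bitLen_le (abs_natCast_le (x := c + 1) (by have := h.total_le.1; lia))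
      push_cast at this; exact this
    have := hu.add_le (hu.add_le (hu.add_le (hu.add_le l5 l10) l1) l2) ht
    exact le_trans (by lia) (this.trans (hu.pow_mono (by norm_num)))

theorem solver_exec : ∃ s t, ∃ a : Answer I.n, Exec solver I.input s t ∧ t ≤ W ^ 200000 ∧
    a.WrittenIn s ∧ a.IsCorrect I := by
  have hu := h.toUnits
  obtain ⟨s, hrun, hE, hQ⟩ := setup_runs h
  have hbest := bestC_term h hE hQ
  have hE' := hE.setReg (x := 9) (by norm_num)
    (argmin (fun c => I.viol (I.xVal c)) (fun c => I.quadVal (I.xVal c)) I.total)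
  have hunb := unbC_term h hE' hQ
  obtain ⟨s₁, t₁, x1, l1, a1⟩ := hrun I.input (.refl _ _)
  obtain ⟨s₂, t₂, x2, l2, a2⟩ := Runs.assign hu hbest 9 s₁ a1
  obtain ⟨s₃, t₃, x3, l3, a3⟩ := Runs.assign hu hunb 10 s₂ a2
  have e10 : s₃.reg 10 = ∑ c ∈ Finset.range I.total, I.cert c := by
    rw [a3.2 10 (by norm_num)]; rfl
  obtain ⟨s₄, t₄, a, x4, l4, hw, hcor⟩ := finish_exec h
    ((hE'.setReg (x := 10) (by norm_num) _).agree le_rfl a3)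
    (by rw [a3.2 9 (by norm_num)]; rfl) e10 (by rw [e10]; exact hunb.abs_le)
  refine ⟨s₄, _, a, .seq x1 (.seq x2 (.seq x3 x4)), ?_, hw, hcor⟩
  have := hu.add_le l1 (hu.add_le l2 (hu.add_le l3 l4))
  exact this.trans (hu.pow_mono (by norm_num))

end Running

/-- The factor of the running time that depends on the number of variables and the size of the
coefficients. -/
def costFactor (n a : ℕ) : ℕ :=
  let base := 2 * a + 1
  let rows := base ^ n
  let bnd := (n + a + 2) ^ boundExp n
  let dg := 2 * bnd + 1
  let len := n * (rows + 2) + 1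
  base + rows + bnd + dg + len + dg ^ len + (4 * n + 4) + (4 * n + 4) ^ n + (n + a + 2) +
    boundExp n + 4

/-- `F` bounds every quantity that depends on `n` and `α` only, including the number of recipes. The
remaining ones are `m ≤ L` and `|b i| ≤ 2 ^ L`. The units fit together since `F * 2 ^ L < 2 ^ (F +
L)` and `F + L ≤ F * L`. -/
theorem sizes (I : IQP) :
    I.Sizes (costFactor I.n I.alpha * 2 ^ I.size) (costFactor I.n I.alpha * I.size) := by
  generalize hF : costFactor I.n I.alpha = F
  have hF' : I.base + I.rows + I.bnd + I.dg + I.len + I.total + (4 * I.n + 4) +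
      (4 * I.n + 4) ^ I.n + (I.n + I.alpha + 2) + boundExp I.n + 4 = F := hF
  have hL2 : 2 ≤ I.size := by
    unfold size bitLen; lia
  -- Each of the `m` right-hand sides contributes at least one bit.
  have hm : I.m ≤ I.size := by
    have : ∑ i : Fin I.m, 1 ≤ ∑ i, bitLen (I.b i) :=
      Finset.sum_le_sum fun i _ => by unfold bitLen; lia
    simp only [Finset.sum_const, Finset.card_univ, Fintype.card_fin, smul_eq_mul, mul_one] at this
    unfold size
    lia
  have hU : ∀ x ≤ F, x ≤ F * 2 ^ I.size := fun x hx => hx.trans (Nat.le_mul_of_pos_right _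
    (by positivity))
  have hW : ∀ x ≤ F, x ≤ F * I.size := fun x hx => hx.trans (Nat.le_mul_of_pos_right _ (by lia))
  have hUW : ∀ x ≤ F, x ≤ F * 2 ^ I.size ∧ x ≤ F * I.size := fun x hx => ⟨hU x hx, hW x hx⟩
  have hL : I.size < 2 ^ I.size := Nat.lt_two_pow_self
  refine ⟨⟨hU 2 (by lia), hW 4 (by lia), ?_⟩, hUW _ (by lia), ⟨?_, ?_⟩, hU _ (by lia),
    hU _ (by lia), hUW _ (by lia), hU _ (by lia), hU _ (by lia), hUW _ (by lia), hUW _ (by lia),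
    hU _ (by lia), hU _ (by lia), hU _ (by lia), hUW _ (by lia), fun i => ?_⟩
  · rw [Nat.size_le]
    have h1 : F < 2 ^ F := Nat.lt_two_pow_self
    calc F * 2 ^ I.size < 2 ^ F * 2 ^ I.size := by gcongr
      _ = 2 ^ (F + I.size) := (pow_add _ _ _).symm
      _ ≤ 2 ^ (F * I.size) := Nat.pow_le_pow_right (by norm_num) (by
          have : 4 ≤ F := by lia
          nlinarith)
  · exact (hm.trans hL.le).trans (Nat.le_mul_of_pos_left _ (by lia))
  · exact hm.trans (Nat.le_mul_of_pos_left _ (by lia))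
  · have h1 : bitLen (I.b i) ≤ I.size := by
      have : bitLen (I.b i) ≤ ∑ i, bitLen (I.b i) :=
        Finset.single_le_sum (f := fun i => bitLen (I.b i)) (fun _ _ => Nat.zero_le _)
          (Finset.mem_univ i)
      unfold size
      lia
    have h2 : (I.b i).natAbs < 2 ^ I.size :=
      Nat.size_le.1 (le_trans (Nat.le_succ _) h1)
    rw [Int.abs_eq_natAbs]
    exact_mod_cast h2.le.trans (Nat.le_mul_of_pos_left _ (by lia))

end IQP

/-- Integer Quadratic Programming is solved in time `f(n, α) · L ^ O(1)`. -/
theorem theorem2 :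
    ∃ (P : RAM.Prog) (f : ℕ → ℕ → ℕ) (c : ℕ), ∀ I : IQP,
      ∃ (s : RAM.State) (t : ℕ) (a : IQP.Answer I.n),
        RAM.Exec P I.input s t ∧ t ≤ f I.n I.alpha * I.size ^ c ∧
          a.WrittenIn s ∧ a.IsCorrect I := by
  -- The time `(F * L) ^ 200000` splits into the two factors; the exponent is the crude total over
  -- the fixed program.
  refine ⟨IQP.solver, fun n a => IQP.costFactor n a ^ 200000, 200000, fun I => ?_⟩
  obtain ⟨s, t, a, h1, h2, h3⟩ := IQP.solver_exec (IQP.sizes I)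
  exact ⟨s, t, a, h1, h2.trans_eq (mul_pow _ _ _), h3⟩
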